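/- Let $I=[0,1]$ with Lebesgue measure $m$, let $1\le p<\infty$, and fix a constant $A>0$. For $f:I\to\mathbb C$, $r>0$ and $x\in I$ put $$\operatorname{osc}(f,r,x)=\sup\{|f(y_1)-f(y_2)| : y_1,y_2\in(x-r,x+r)\cap I\},\qquad \operatorname{var}_{1,1/p}(f)=\sup_{0<r\le A} r^{-1/p}\int_I\operatorname{osc}(f,r,x)\,dm(x).$$ For the class of $f$ modulo $m$-null sets, $\operatorname{var}_{1,1/p}$ is the infimum of this quantity over all versions of $f$; $BV_{1,1/p}$ is the space of classes of integrable functions with $\operatorname{var}_{1,1/p}(f)<\infty$, and $\|f\|_{1,1/p}=\operatorname{var}_{1,1/p}(f)+\|f\|_1$. Let $\tau:I\to I$ be a piecewise expanding $C^{1+1/p}$ map: there are $0=a_0<a_1<\dots<a_q=1$ such that, for each $i$, on $I_i=(a_{i-1},a_i)$ the map $\tau$ is monotonic, extends to a $C^1$ function on $\overline{I_i}$, has a $1/p$-Hölder continuous derivative, and satisfies $|\tau'|\ge s_i>1$. Let $s=\min_i s_i$ and assume $$\frac1{s^{1/p}}+\frac1s<1 .$$ Let $P_\tau$ be the Frobenius–Perron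 operator, $P_\tau f(x)=\sum_{i=1}^q \frac{f(\tau_i^{-1}x)}{|\tau'(\tau_i^{-1}x)|}\chi_{\tau(I_i)}(x)$ with $\tau_i=\tau|_{I_i}$. Then for every sufficiently small $A>0$ (depending on $\tau$ and $p$) there are constants $0<\alpha<1$ and $K>0$ such that: 1. $\|P_\tau f\|_{1,1/p}\le\alpha\|f\|_{1,1/p}+K\|f\|_1$ for all $f\in BV_{1,1/p}$; 2. the iterates of $P_\tau$ are uniformly bounded on $BV_{1,1/p}$: for all $f\in BV_{1,1/p}$ and all $n\ge 0$, $P_\tau^nf\in BV_{1,1/p}$ and $\|P_\tau^nf\|_{1,1/p}\le\left(1+\frac K{1-\alpha}\right)\|f\|_{1,1/p}$; 3. for every $f\in BV_{1,1/p}$ and all sufficiently large $n$ (depending on $f$), $$\|P_\tau^n f\|_{1,1/p}\le\Bigl(1+\frac{K}{1-\alpha}\Bigr)\|f\|_1 .$$ -/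

import Mathlib

open MeasureTheory Set Filter

noncomputable section

namespace GenBV

/-- Lebesgue measure on the unit interval `I = [0, 1]`. Functions on `I` are represented by
functions on `ℝ`, of which only the values on `I` are ever used. -/
def mI : Measure ℝ := volume.restrict (Icc (0 : ℝ) 1)

/-- `S_r(x) = (x - r, x + r) ∩ I`. -/
def nbhd (r x : ℝ) : Set ℝ := Ioo (x - r) (x + r) ∩ Icc 0 1

/-- The oscillation `osc(f, r, x) = sup_{y₁, y₂ ∈ S_r(x)} |f(y₁) - f(y₂)|`, with value in `[0, ∞]`. -/
def osc (f : ℝ → ℂ) (r x : ℝ) : ENNReal :=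
  ⨆ y₁ ∈ nbhd r x, ⨆ y₂ ∈ nbhd r x, ‖f y₁ - f y₂‖ₑ

/-- `osc₁(f, r)`, the `L¹`-norm over `I` of `osc(f, r, ·)`. -/
def oscOne (f : ℝ → ℂ) (r : ℝ) : ENNReal := ∫⁻ x, osc f r x ∂mI

/-- `var_{1,1/p}(f) = sup_{0 < r ≤ A} osc₁(f, r) / r^{1/p}` of a function. -/
def varFun (A p : ℝ) (f : ℝ → ℂ) : ENNReal :=
  ⨆ r ∈ Ioc (0 : ℝ) A, oscOne f r / ENNReal.ofReal (r ^ (1 / p))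

/-- `var_{1,1/p}` of the equivalence class of `f` modulo Lebesgue null sets:
the infimum of the variations of the versions of `f`. -/
def var (A p : ℝ) (f : ℝ → ℂ) : ENNReal :=
  ⨅ (g : ℝ → ℂ) (_ : g =ᵐ[mI] f), varFun A p g

/-- The `L¹`-norm over `I`. -/
def normOne (f : ℝ → ℂ) : ENNReal := ∫⁻ x, ‖f x‖ₑ ∂mI

/-- The norm `‖f‖_{1,1/p} = var_{1,1/p}(f) + ‖f‖₁` (of the class of `f`). -/
def normBV (A p : ℝ) (f : ℝ → ℂ) : ENNReal := var A p f + normOne f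

/-- The class of `f` belongs to `BV_{1,1/p}`. -/
def MemBV (A p : ℝ) (f : ℝ → ℂ) : Prop := Integrable f mI ∧ var A p f < ⊤

/-- The `i`-th open interval `(a_{i-1}, a_i)` of the partition with the endpoints `a`. -/
def piece {q : ℕ} (a : Fin (q + 1) → ℝ) (i : Fin q) : Set ℝ := Ioo (a i.castSucc) (a i.succ)

/-- `τ` is a piecewise expanding `C^{1+ε}` map of `I`, with respect to the partition
`0 = a₀ < a₁ < ⋯ < a_q = 1` and with the lower bounds `s i` of the slopes. -/
structure IsPiecewiseExpanding (ε : ℝ) {q : ℕ} (a : Fin (q + 1) → ℝ) (s : Fin q → ℝ)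
    (τ : ℝ → ℝ) : Prop where
  strictMono : StrictMono a
  first : a 0 = 0
  last : a (Fin.last q) = 1
  mapsTo : MapsTo τ (Icc 0 1) (Icc 0 1)
  monotonic : ∀ i, MonotoneOn τ (piece a i) ∨ AntitoneOn τ (piece a i)
  extends_C1 : ∀ i, ∃ τi : ℝ → ℝ,
    ContDiffOn ℝ 1 τi (Icc (a i.castSucc) (a i.succ)) ∧ EqOn τi τ (piece a i)
  holder : ∀ i, ∃ M : ℝ, ∀ x ∈ piece a i, ∀ y ∈ piece a i,
    |deriv τ x - deriv τ y| ≤ M * |x - y| ^ ε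
  one_lt : ∀ i, 1 < s i
  expanding : ∀ i, ∀ x ∈ piece a i, s i ≤ |deriv τ x|

/-- The Frobenius-Perron operator
`P_τ f (x) = ∑ᵢ f(τᵢ⁻¹ x) / |τ'(τᵢ⁻¹ x)| · χ_{τ(Iᵢ)}(x)`,
where `τᵢ⁻¹` is the inverse of the restriction of `τ` to the `i`-th interval of the partition. -/
def frobeniusPerron {q : ℕ} (a : Fin (q + 1) → ℝ) (τ : ℝ → ℝ) (f : ℝ → ℂ) : ℝ → ℂ :=
  fun x => ∑ i : Fin q, (τ '' piece a i).indicator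
    (fun x => f (Function.invFunOn τ (piece a i) x) /
      (|deriv τ (Function.invFunOn τ (piece a i) x)| : ℝ)) x

end GenBV

end

open MeasureTheory Set Filter

noncomputable section

namespace GenBV


/-! The core is a Lasota-Yorke inequality for the variation alone, `exists_var_frobeniusPerron_le`.
Since the operator does not increase the L¹-norm, the inequality passes to the full norm. Iterating
it gives a geometric series, and the leading term `α ^ n * ‖f‖` eventually drops below any nonzero
`‖f‖₁`.

At a fixed radius `r` the inequality combines two estimates. The first is
`lintegral_oscIn_transfer`. An increasing branch of slope at least `σ` pulls a window of radius `r`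
back into one of radius `r / σ`, and its Jacobian cancels the weight `1 / τ'`; decreasing branches
follow by reflection. The Hölder condition bounds the relative variation of the weight by `M * r ^
(1 / p)`, which a small `A` makes negligible. What remains is the oscillation, over the whole line,
of `f` cut off to one piece, at scale `ρ = r / s` with `s` the least slope.

The second estimate is the price of the cut-off. The jump at an endpoint must be charged to the
values and oscillations of `f` inside the piece. Dilating about the endpoint by `R / ρ` spreads a
layer of width `ρ` over one of width `R` and gains a factor `ρ / R`. For `p > 1` take `R = A`:
relative to `r ^ (1 / p)` one such layer costs `(r / A) ^ (1 - 1 / p) / s`. If `r` is comparable to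
`A`, dilation is used only outside the piece and a full `‖f‖₁` is paid inside
(`lintegral_branch_le_inner`). If `r` is much smaller, it is used on both sides, and the power of `r
/ A` absorbs the factor two (`lintegral_branch_le_double`). Either way the total is at most `1 / s ^
(1 / p) + 1 / s`.

For `p = 1` that power gives no gain. There the boundary value is followed along about `A / r`
adjacent windows and averaged (`lintegral_branch_le_chain`). The windows tile an interval, so the
cost is one more oscillation integral at a scale just above `r / s`, plus `‖f‖₁` times at most `r /
A`; the total factor is slightly more than `2 / s < 1`. -/

/-! ### Oscillation over windows in a set -/

/-- The oscillation of `f` over the part in `U` of the window of radius `r` around `x`. -/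
def oscIn (U : Set ℝ) (f : ℝ → ℂ) (r x : ℝ) : ENNReal :=
  ⨆ y₁ ∈ Ioo (x - r) (x + r) ∩ U, ⨆ y₂ ∈ Ioo (x - r) (x + r) ∩ U, ‖f y₁ - f y₂‖ₑ

lemma osc_eq_oscIn (f : ℝ → ℂ) (r x : ℝ) : osc f r x = oscIn (Icc 0 1) f r x := rfl

lemma enorm_sub_le_oscIn {U : Set ℝ} {f : ℝ → ℂ} {r x y₁ y₂ : ℝ}
    (h₁ : y₁ ∈ Ioo (x - r) (x + r) ∩ U) (h₂ : y₂ ∈ Ioo (x - r) (x + r) ∩ U) :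
    ‖f y₁ - f y₂‖ₑ ≤ oscIn U f r x :=
  (le_iSup₂ (f := fun y _ => ‖f y₁ - f y‖ₑ) y₂ h₂).trans
    (le_iSup₂ (f := fun y _ => ⨆ y₂ ∈ Ioo (x - r) (x + r) ∩ U, ‖f y - f y₂‖ₑ) y₁ h₁)

lemma oscIn_le {U : Set ℝ} {f : ℝ → ℂ} {r x : ℝ} {c : ENNReal}
    (h : ∀ y₁ ∈ Ioo (x - r) (x + r) ∩ U, ∀ y₂ ∈ Ioo (x - r) (x + r) ∩ U,
      ‖f y₁ - f y₂‖ₑ ≤ c) : oscIn U f r x ≤ c :=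
  iSup₂_le fun y₁ h₁ => iSup₂_le fun y₂ h₂ => h y₁ h₁ y₂ h₂

lemma enorm_le_oscIn_add {U : Set ℝ} {f : ℝ → ℂ} {r x y₁ y₂ : ℝ}
    (h₁ : y₁ ∈ Ioo (x - r) (x + r) ∩ U) (h₂ : y₂ ∈ Ioo (x - r) (x + r) ∩ U) :
    ‖f y₁‖ₑ ≤ oscIn U f r x + ‖f y₂‖ₑ := by
  have h := enorm_add_le (f y₁ - f y₂) (f y₂)
  rw [sub_add_cancel] at h
  exact h.trans (add_le_add_left (enorm_sub_le_oscIn h₁ h₂) _)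

/-- The windows are open, so a pair of points nearly attaining the supremum at `x` still lies in the
windows of nearby centres: the oscillation is lower semicontinuous for arbitrary `f`. -/
lemma measurable_oscIn (U : Set ℝ) (f : ℝ → ℂ) (r : ℝ) : Measurable (oscIn U f r) := by
  refine LowerSemicontinuous.measurable fun x c hc => ?_
  have hx : c < ⨆ y₁ ∈ Ioo (x - r) (x + r) ∩ U, ⨆ y₂ ∈ Ioo (x - r) (x + r) ∩ U,
    ‖f y₁ - f y₂‖ₑ := hc
  simp only [lt_iSup_iff] at hx
  obtain ⟨y₁, h₁, y₂, h₂, h⟩ := hx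
  have key : ∀ y ∈ Ioo (x - r) (x + r), ∀ᶠ x' in nhds x, y ∈ Ioo (x' - r) (x' + r) := by
    intro y hy
    have e₁ : ∀ᶠ x' in nhds x, x' - r < y :=
      (continuous_id.sub continuous_const).continuousAt.eventually_lt continuousAt_const hy.1
    have e₂ : ∀ᶠ x' in nhds x, y < x' + r :=
      continuousAt_const.eventually_lt (continuous_id.add continuous_const).continuousAt hy.2
    filter_upwards [e₁, e₂] with x' a b using ⟨a, b⟩
  filter_upwards [key y₁ h₁.1, key y₂ h₂.1] with x' a b
  exact h.trans_le (enorm_sub_le_oscIn ⟨a, h₁.2⟩ ⟨b, h₂.2⟩)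

lemma oscIn_sum_le {ι : Type*} (t : Finset ι) (U : Set ℝ) (g : ι → ℝ → ℂ) (r x : ℝ) :
    oscIn U (fun y => ∑ i ∈ t, g i y) r x ≤ ∑ i ∈ t, oscIn univ (g i) r x := by
  refine oscIn_le fun y₁ h₁ y₂ h₂ => ?_
  rw [← Finset.sum_sub_distrib]
  refine (enorm_sum_le _ _).trans (Finset.sum_le_sum fun i _ => ?_)
  exact enorm_sub_le_oscIn ⟨h₁.1, mem_univ _⟩ ⟨h₂.1, mem_univ _⟩

lemma oscIn_comp_neg (g : ℝ → ℂ) (r x : ℝ) :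
    oscIn univ (fun y => g (-y)) r x = oscIn univ g r (-x) := by
  refine le_antisymm (oscIn_le fun y₁ h₁ y₂ h₂ => ?_) (oscIn_le fun y₁ h₁ y₂ h₂ => ?_)
  · refine enorm_sub_le_oscIn (f := g) (y₁ := -y₁) (y₂ := -y₂) ?_ ?_ <;>
      simp only [mem_inter_iff, mem_Ioo, mem_univ, and_true] at * <;> constructor <;> linarith
  · have := enorm_sub_le_oscIn (f := fun y => g (-y)) (r := r) (x := x) (U := univ)
      (y₁ := -y₁) (y₂ := -y₂) (by
        simp only [mem_inter_iff, mem_Ioo, mem_univ, and_true] at *; constructor <;> linarith)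
      (by simp only [mem_inter_iff, mem_Ioo, mem_univ, and_true] at *; constructor <;> linarith)
    simpa using this

lemma lintegral_oscIn_comp_neg (g : ℝ → ℂ) (r : ℝ) :
    ∫⁻ x, oscIn univ (fun y => g (-y)) r x = ∫⁻ x, oscIn univ g r x := by
  simp only [oscIn_comp_neg]
  exact lintegral_neg_eq_self (oscIn univ g r)

/-- Affine change of variables. -/
lemma setLIntegral_image_affine (S : Set ℝ) (hS : MeasurableSet S) (c k : ℝ) (hk : k ≠ 0)
    (F : ℝ → ENNReal) :
    ∫⁻ y in (fun z => c + k * z) '' S, F y = ENNReal.ofReal |k| * ∫⁻ z in S, F (c + k * z) := by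
  have hd : ∀ x ∈ S, HasDerivWithinAt (fun z => c + k * z) k S x := fun x _ => by
    simpa using (((hasDerivAt_id x).const_mul k).const_add c).hasDerivWithinAt
  rw [lintegral_image_eq_lintegral_abs_deriv_mul hS hd, lintegral_const_mul' _ _ (by simp)]
  intro x _ y _ h
  simpa [hk] using h


/-! ### Transfer of oscillation through one branch -/

lemma enorm_real_mul (k : ℝ) (hk : 0 ≤ k) (z : ℂ) : ‖(k : ℂ) * z‖ₑ = ENNReal.ofReal k * ‖z‖ₑ := by
  rw [enorm_mul, ← ofReal_norm (k : ℂ), Complex.norm_real, Real.norm_of_nonneg hk]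

/-- The error is relative to `‖G w‖`, which is at most the oscillation of `G` plus `‖G z‖`. The
constant weight `k` factors out, to be cancelled later by the Jacobian. -/
lemma oscIn_le_of_near {g G : ℝ → ℂ} {r x ρ z k c : ℝ} (hρ : 0 < ρ) (hk : 0 ≤ k) (hc : 0 ≤ c)
    (h : ∀ y ∈ Ioo (x - r) (x + r), ∃ w ∈ Ioo (z - ρ) (z + ρ),
      ‖g y - (k : ℂ) * G w‖ ≤ k * c * ‖G w‖) :
    oscIn univ g r x ≤ ENNReal.ofReal k * ((1 + ENNReal.ofReal (2 * c)) * oscIn univ G ρ z +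
      ENNReal.ofReal (2 * c) * ‖G z‖ₑ) := by
  have hz : z ∈ Ioo (z - ρ) (z + ρ) := ⟨by linarith, by linarith⟩
  refine oscIn_le fun y₁ h₁ y₂ h₂ => ?_
  obtain ⟨w₁, hw₁, e₁⟩ := h y₁ h₁.1
  obtain ⟨w₂, hw₂, e₂⟩ := h y₂ h₂.1
  have key : ∀ y w : ℝ, w ∈ Ioo (z - ρ) (z + ρ) → ‖g y - (k : ℂ) * G w‖ ≤ k * c * ‖G w‖ →
      ‖g y - (k : ℂ) * G w‖ₑ ≤
        ENNReal.ofReal k * (ENNReal.ofReal c * (oscIn univ G ρ z + ‖G z‖ₑ)) := by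
    intro y w hw e
    have : ‖g y - (k : ℂ) * G w‖ₑ ≤ ENNReal.ofReal (k * c) * ‖G w‖ₑ := by
      rw [← ofReal_norm, ← ofReal_norm, ← ENNReal.ofReal_mul (by positivity)]
      exact ENNReal.ofReal_le_ofReal e
    rw [ENNReal.ofReal_mul hk, mul_assoc] at this
    refine this.trans ?_
    gcongr
    exact enorm_le_oscIn_add ⟨hw, mem_univ _⟩ ⟨hz, mem_univ _⟩
  have split : g y₁ - g y₂ = (g y₁ - (k : ℂ) * G w₁) + (k : ℂ) * (G w₁ - G w₂) -
      (g y₂ - (k : ℂ) * G w₂) := by ring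
  rw [split]
  refine (enorm_sub_le).trans ((add_le_add_left (enorm_add_le _ _) _).trans ?_)
  rw [enorm_real_mul k hk]
  have hm : ‖G w₁ - G w₂‖ₑ ≤ oscIn univ G ρ z :=
    enorm_sub_le_oscIn ⟨hw₁, mem_univ _⟩ ⟨hw₂, mem_univ _⟩
  calc _ ≤ ENNReal.ofReal k * (ENNReal.ofReal c * (oscIn univ G ρ z + ‖G z‖ₑ)) +
        ENNReal.ofReal k * oscIn univ G ρ z +
        ENNReal.ofReal k * (ENNReal.ofReal c * (oscIn univ G ρ z + ‖G z‖ₑ)) := by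
        gcongr
        · exact key _ _ hw₁ e₁
        · exact key _ _ hw₂ e₂
    _ = _ := by
        rw [ENNReal.ofReal_mul (by norm_num : (0 : ℝ) ≤ 2), ENNReal.ofReal_ofNat]
        ring

/-- Splitting off the smaller weight leaves coefficients `θ₂` and `θ₁ - θ₂`, whose sum is only the
larger weight. -/
lemma enorm_weighted_sub_le {a b : ℂ} {θ₁ θ₂ k : ℝ} {O : ENNReal} (h₂ : 0 ≤ θ₂) (h₁₂ : θ₂ ≤ θ₁)
    (hk : θ₁ ≤ k) (hab : ‖a - b‖ₑ ≤ O) (ha : ‖a‖ₑ ≤ O) :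
    ‖(θ₁ : ℂ) * a - (θ₂ : ℂ) * b‖ₑ ≤ ENNReal.ofReal k * O := by
  have : (θ₁ : ℂ) * a - (θ₂ : ℂ) * b = (θ₂ : ℂ) * (a - b) + ((θ₁ - θ₂ : ℝ) : ℂ) * a := by
    push_cast; ring
  rw [this]
  refine (enorm_add_le _ _).trans ?_
  rw [enorm_real_mul _ h₂, enorm_real_mul _ (by linarith)]
  calc _ ≤ ENNReal.ofReal θ₂ * O + ENNReal.ofReal (θ₁ - θ₂) * O := by gcongr
    _ = ENNReal.ofReal θ₁ * O := by
      rw [← add_mul, ← ENNReal.ofReal_add h₂ (by linarith)]; ring_nf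
    _ ≤ _ := by gcongr

/-- A zero of `G` in the window bounds the values of `G` there by its oscillation. Varying weights
then cost nothing, so no distortion estimate is needed outside the image of a branch. -/
lemma oscIn_le_of_weights {g G : ℝ → ℂ} {r x ρ z k : ℝ}
    (h : ∀ y ∈ Ioo (x - r) (x + r), ∃ w ∈ Ioo (z - ρ) (z + ρ), ∃ θ : ℝ, 0 ≤ θ ∧ θ ≤ k ∧
      g y = (θ : ℂ) * G w)
    (h0 : ∃ w ∈ Ioo (z - ρ) (z + ρ), G w = 0) :
    oscIn univ g r x ≤ ENNReal.ofReal k * oscIn univ G ρ z := by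
  obtain ⟨w₀, hw₀, g0⟩ := h0
  refine oscIn_le fun y₁ h₁ y₂ h₂ => ?_
  obtain ⟨w₁, hw₁, θ₁, p₁, q₁, e₁⟩ := h y₁ h₁.1
  obtain ⟨w₂, hw₂, θ₂, p₂, q₂, e₂⟩ := h y₂ h₂.1
  have hn : ∀ w ∈ Ioo (z - ρ) (z + ρ), ‖G w‖ₑ ≤ oscIn univ G ρ z := fun w hw => by
    simpa [g0] using
      enorm_sub_le_oscIn (f := G) (U := univ) ⟨hw, mem_univ _⟩ ⟨hw₀, mem_univ _⟩
  have hs : ∀ w ∈ Ioo (z - ρ) (z + ρ), ∀ w' ∈ Ioo (z - ρ) (z + ρ),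
      ‖G w - G w'‖ₑ ≤ oscIn univ G ρ z := fun w hw w' hw' =>
    enorm_sub_le_oscIn ⟨hw, mem_univ _⟩ ⟨hw', mem_univ _⟩
  rw [e₁, e₂]
  rcases le_total θ₂ θ₁ with H | H
  · exact enorm_weighted_sub_le p₂ H q₁ (hs _ hw₁ _ hw₂) (hn _ hw₁)
  · rw [← enorm_neg, neg_sub]
    exact enorm_weighted_sub_le p₁ H q₂ (hs _ hw₂ _ hw₁) (hn _ hw₂)

lemma mul_sub_le_sub_of_le_deriv {u v σ : ℝ} (hσ : 0 < σ) {τ : ℝ → ℝ}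
    (hder : ∀ w ∈ Ioo u v, σ ≤ deriv τ w) {w₁ w₂ : ℝ} (h₁ : w₁ ∈ Ioo u v) (h₂ : w₂ ∈ Ioo u v)
    (h : w₁ ≤ w₂) : σ * (w₂ - w₁) ≤ τ w₂ - τ w₁ := by
  have hd : ∀ w ∈ Ioo u v, DifferentiableAt ℝ τ w := fun w hw =>
    differentiableAt_of_deriv_ne_zero (hσ.trans_le (hder w hw)).ne'
  refine (convex_Ioo u v).mul_sub_le_image_sub_of_le_deriv
    (fun w hw => (hd w hw).continuousAt.continuousWithinAt)
    (fun w hw => (hd w (interior_subset hw)).differentiableWithinAt)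
    (fun w hw => hder w (interior_subset hw)) w₁ h₁ w₂ h₂ h

/-- The variation of a transfer operator term of an increasing branch. -/
lemma lintegral_oscIn_transfer {u v σ ε M r : ℝ} (huv : u < v) (hσ : 1 ≤ σ) (hε : 0 ≤ ε)
    (hM0 : 0 ≤ M) (hr : 0 < r) {τ : ℝ → ℝ} {f g : ℝ → ℂ}
    (hder : ∀ w ∈ Ioo u v, σ ≤ deriv τ w)
    (hM : ∀ x ∈ Ioo u v, ∀ y ∈ Ioo u v, |deriv τ x - deriv τ y| ≤ M * |x - y| ^ ε)
    (hb : BddBelow (τ '' Ioo u v)) (hB : BddAbove (τ '' Ioo u v))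
    (hg : ∀ w ∈ Ioo u v, g (τ w) = f w / (deriv τ w : ℝ))
    (hg0 : ∀ x, x ∉ τ '' Ioo u v → g x = 0) :
    ∫⁻ x, oscIn univ g r x ≤
      (1 + ENNReal.ofReal (2 * (M * r ^ ε))) *
        (∫⁻ z, oscIn univ ((Ioo u v).indicator f) (r / σ) z) +
      ENNReal.ofReal (2 * (M * r ^ ε)) * ∫⁻ z in Ioo u v, ‖f z‖ₑ := by
  have hσ0 : 0 < σ := by linarith
  set ρ := r / σ with hρdef
  have hρ : 0 < ρ := div_pos hr hσ0
  have hσρ : σ * ρ = r := by rw [hρdef]; field_simp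
  have hρr : ρ ≤ r := by rw [← hσρ]; nlinarith
  set G := (Ioo u v).indicator f with hG
  set O := fun z => oscIn univ G ρ z with hO
  set c := M * r ^ ε with hc
  have hc0 : 0 ≤ c := by positivity
  have hd : ∀ w ∈ Ioo u v, DifferentiableAt ℝ τ w := fun w hw =>
    differentiableAt_of_deriv_ne_zero (hσ0.trans_le (hder w hw)).ne'
  have hexp : ∀ w₁ ∈ Ioo u v, ∀ w₂ ∈ Ioo u v, w₁ ≤ w₂ → σ * (w₂ - w₁) ≤ τ w₂ - τ w₁ :=
    fun w₁ h₁ w₂ h₂ h => mul_sub_le_sub_of_le_deriv hσ0 hder h₁ h₂ h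
  have hinj : InjOn τ (Ioo u v) := by
    intro w₁ h₁ w₂ h₂ h
    rcases le_total w₁ w₂ with H | H
    · have := hexp _ h₁ _ h₂ H; nlinarith
    · have := hexp _ h₂ _ h₁ H; nlinarith
  have hpos : ∀ w ∈ Ioo u v, 0 < deriv τ w := fun w hw => hσ0.trans_le (hder w hw)
  have hg' : ∀ w ∈ Ioo u v, g (τ w) = (((deriv τ w)⁻¹ : ℝ) : ℂ) * G w := fun w hw => by
    rw [hg w hw, hG, indicator_of_mem hw, Complex.ofReal_inv, div_eq_inv_mul]
  have hGu : ∀ z ≤ u, G z = 0 := fun z hz => indicator_of_notMem (fun h => by linarith [h.1]) _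
  have hGv : ∀ z, v ≤ z → G z = 0 := fun z hz =>
    indicator_of_notMem (fun h => by linarith [h.2]) _
  set J := τ '' Ioo u v with hJ
  have hJne : J.Nonempty := (nonempty_Ioo.2 huv).image _
  set b := sInf J with hbdef
  set B := sSup J with hBdef
  have hJpre : IsPreconnected J := isPreconnected_Ioo.image _
    fun w hw => (hd w hw).continuousAt.continuousWithinAt
  have hcover : Ioo b B ⊆ J := IsConnected.Ioo_csInf_csSup_subset ⟨hJne, hJpre⟩ hb hB
  -- Expansion measured from the endpoint, with the infimum `b` in place of a boundary value of `τ`: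
  -- a failure would contradict expansion from some `w'` close enough to `u`.
  have hbw : ∀ w ∈ Ioo u v, σ * (w - u) ≤ τ w - b := by
    intro w hw
    by_contra! hcon
    have h1 : u < min w (u + (σ * (w - u) - (τ w - b)) / σ) :=
      lt_min hw.1 (by have : 0 < (σ * (w - u) - (τ w - b)) / σ := by
                        apply div_pos _ hσ0; linarith
                      linarith)
    obtain ⟨w', h2, h3⟩ := exists_between h1
    have h4 := lt_min_iff.1 h3
    have hw' : w' ∈ Ioo u v := ⟨h2, h4.1.trans hw.2⟩
    have h5 := hexp _ hw' _ hw h4.1.le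
    have h6 : b ≤ τ w' := csInf_le hb ⟨w', hw', rfl⟩
    have h7 : w' - u < (σ * (w - u) - (τ w - b)) / σ := by linarith [h4.2]
    rw [lt_div_iff₀ hσ0] at h7
    nlinarith
  have hBw : ∀ w ∈ Ioo u v, σ * (v - w) ≤ B - τ w := by
    intro w hw
    by_contra! hcon
    have h1 : max w (v - (σ * (v - w) - (B - τ w)) / σ) < v :=
      max_lt hw.2 (by have : 0 < (σ * (v - w) - (B - τ w)) / σ := by
                        apply div_pos _ hσ0; linarith
                      linarith)
    obtain ⟨w', h3, h2⟩ := exists_between h1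
    have h4 := max_lt_iff.1 h3
    have hw' : w' ∈ Ioo u v := ⟨hw.1.trans h4.1, h2⟩
    have h5 := hexp _ hw _ hw' h4.1.le
    have h6 : τ w' ≤ B := le_csSup hB ⟨w', hw', rfl⟩
    have h7 : v - w' < (σ * (v - w) - (B - τ w)) / σ := by linarith [h4.2]
    rw [lt_div_iff₀ hσ0] at h7
    nlinarith
  have hwt : ∀ w ∈ Ioo u v, 0 ≤ (deriv τ w)⁻¹ ∧ (deriv τ w)⁻¹ ≤ σ⁻¹ := fun w hw =>
    ⟨(inv_pos.2 (hpos w hw)).le, inv_anti₀ hσ0 (hder w hw)⟩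
  have hcancel : ENNReal.ofReal σ * ENNReal.ofReal σ⁻¹ = 1 := by
    rw [← ENNReal.ofReal_mul hσ0.le, mul_inv_cancel₀ hσ0.ne', ENNReal.ofReal_one]
  -- to the left of the image
  have left : ∫⁻ x in Iic b, oscIn univ g r x ≤ ∫⁻ z in Iic u, O z := by
    -- The branch is continued beyond `u` by the affine map of slope `σ`. Its Jacobian cancels the
    -- bound `σ⁻¹` on the weights, and by `hbw` the preimages of points of `J` in a window of radius
    -- `r` lie in the corresponding window of radius `ρ`.
    have himg : (fun z => (b - σ * u) + σ * z) '' Iic u = Iic b := by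
      ext x; constructor
      · rintro ⟨z, hz, rfl⟩
        simp only [mem_Iic] at *; nlinarith
      · intro hx
        refine ⟨u + (x - b) / σ, ?_, by field_simp; ring⟩
        simp only [mem_Iic] at *
        have : (x - b) / σ ≤ 0 := div_nonpos_of_nonpos_of_nonneg (by linarith) hσ0.le
        linarith
    rw [← himg, setLIntegral_image_affine _ measurableSet_Iic _ _ hσ0.ne', abs_of_pos hσ0,
      ← lintegral_const_mul' _ _ ENNReal.ofReal_ne_top]
    refine setLIntegral_mono' measurableSet_Iic fun z hz => ?_
    rw [← one_mul (O z), ← hcancel, mul_assoc]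
    gcongr
    have hzz : z ∈ Ioo (z - ρ) (z + ρ) := ⟨by linarith, by linarith⟩
    refine oscIn_le_of_weights (fun y hy => ?_) ⟨z, hzz, hGu z hz⟩
    by_cases hyJ : y ∈ J
    · obtain ⟨w, hw, rfl⟩ := hyJ
      refine ⟨w, ⟨by have := hw.1; simp only [mem_Iic] at hz; linarith, ?_⟩, _, (hwt w hw).1,
        (hwt w hw).2, hg' w hw⟩
      have h1 := hbw w hw
      have h2 := hy.2
      have : σ * (w - z - ρ) < 0 := by nlinarith
      by_contra! hcon
      have : 0 ≤ σ * (w - z - ρ) := mul_nonneg hσ0.le (by linarith)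
      linarith
    · exact ⟨z, hzz, 0, le_rfl, (inv_pos.2 hσ0).le, by rw [hg0 y hyJ]; simp⟩
  -- to the right of the image
  have right : ∫⁻ x in Ici B, oscIn univ g r x ≤ ∫⁻ z in Ici v, O z := by
    have himg : (fun z => (B - σ * v) + σ * z) '' Ici v = Ici B := by
      ext x; constructor
      · rintro ⟨z, hz, rfl⟩
        simp only [mem_Ici] at *; nlinarith
      · intro hx
        refine ⟨v + (x - B) / σ, ?_, by field_simp; ring⟩
        simp only [mem_Ici] at *
        have : 0 ≤ (x - B) / σ := div_nonneg (by linarith) hσ0.le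
        linarith
    rw [← himg, setLIntegral_image_affine _ measurableSet_Ici _ _ hσ0.ne', abs_of_pos hσ0,
      ← lintegral_const_mul' _ _ ENNReal.ofReal_ne_top]
    refine setLIntegral_mono' measurableSet_Ici fun z hz => ?_
    rw [← one_mul (O z), ← hcancel, mul_assoc]
    gcongr
    have hzz : z ∈ Ioo (z - ρ) (z + ρ) := ⟨by linarith, by linarith⟩
    refine oscIn_le_of_weights (fun y hy => ?_) ⟨z, hzz, hGv z hz⟩
    by_cases hyJ : y ∈ J
    · obtain ⟨w, hw, rfl⟩ := hyJ
      refine ⟨w, ⟨?_, by have := hw.2; simp only [mem_Ici] at hz; linarith⟩, _, (hwt w hw).1,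
        (hwt w hw).2, hg' w hw⟩
      have h1 := hBw w hw
      have h2 := hy.1
      have : σ * (z - ρ - w) < 0 := by nlinarith
      by_contra! hcon
      have : 0 ≤ σ * (z - ρ - w) := mul_nonneg hσ0.le (by linarith)
      linarith
    · exact ⟨z, hzz, 0, le_rfl, (inv_pos.2 hσ0).le, by rw [hg0 y hyJ]; simp⟩
  -- inside the image
  have inside : ∫⁻ x in J, oscIn univ g r x ≤
      (1 + ENNReal.ofReal (2 * c)) * (∫⁻ z in Ioo u v, O z) +
        ENNReal.ofReal (2 * c) * ∫⁻ z in Ioo u v, ‖f z‖ₑ := by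
    rw [hJ, lintegral_image_eq_lintegral_abs_deriv_mul measurableSet_Ioo
      (fun w hw => (hd w hw).hasDerivAt.hasDerivWithinAt) hinj,
      ← lintegral_const_mul _ (measurable_oscIn univ G ρ),
      ← lintegral_const_mul' _ _ ENNReal.ofReal_ne_top,
      ← lintegral_add_left ((measurable_oscIn univ G ρ).const_mul _)]
    refine setLIntegral_mono' measurableSet_Ioo fun z hz => ?_
    rw [abs_of_pos (hpos z hz)]
    have hGz : f z = G z := (indicator_of_mem hz f).symm
    have main : oscIn univ g r (τ z) ≤ ENNReal.ofReal (deriv τ z)⁻¹ *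
        ((1 + ENNReal.ofReal (2 * c)) * O z + ENNReal.ofReal (2 * c) * ‖G z‖ₑ) := by
      refine oscIn_le_of_near hρ (hwt z hz).1 hc0 fun y hy => ?_
      by_cases hyJ : y ∈ J
      · obtain ⟨w, hw, rfl⟩ := hyJ
        have hwz : |w - z| < ρ := by
          by_contra! hcon
          rcases le_total z w with H | H
          · have h1 := hexp _ hz _ hw H
            rw [abs_of_nonneg (by linarith)] at hcon
            have h2 := mul_le_mul_of_nonneg_left hcon hσ0.le
            linarith [hy.2]
          · have h1 := hexp _ hw _ hz H
            rw [abs_of_nonpos (by linarith)] at hcon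
            have h2 := mul_le_mul_of_nonneg_left hcon hσ0.le
            linarith [hy.1]
        refine ⟨w, ⟨by linarith [(abs_lt.1 hwz).1], by linarith [(abs_lt.1 hwz).2]⟩, ?_⟩
        rw [hg' w hw, ← sub_mul, norm_mul, ← Complex.ofReal_sub, Complex.norm_real,
          Real.norm_eq_abs]
        refine mul_le_mul_of_nonneg_right ?_ (norm_nonneg _)
        have hpw := hpos w hw
        have hpz := hpos z hz
        have e : (deriv τ w)⁻¹ - (deriv τ z)⁻¹ =
            (deriv τ z)⁻¹ * ((deriv τ z - deriv τ w) * (deriv τ w)⁻¹) := by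
          field_simp
        rw [e, abs_mul, abs_of_pos (inv_pos.2 hpz)]
        refine mul_le_mul_of_nonneg_left ?_ (inv_pos.2 hpz).le
        rw [abs_mul, abs_of_pos (inv_pos.2 hpw)]
        have h1 : |deriv τ z - deriv τ w| ≤ c := by
          refine (hM z hz w hw).trans ?_
          rw [hc]
          refine mul_le_mul_of_nonneg_left ?_ hM0
          refine Real.rpow_le_rpow (abs_nonneg _) ?_ hε
          rw [abs_sub_comm]; linarith
        have h2 : (deriv τ w)⁻¹ ≤ 1 := inv_le_one_of_one_le₀ (hσ.trans (hder w hw))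
        calc _ ≤ c * 1 := mul_le_mul h1 h2 (inv_pos.2 hpw).le hc0
          _ = c := mul_one c
      -- A window that leaves the image passes `b` or `B`; by expansion the window at `z` then
      -- reaches `u` or `v`, where `G` vanishes just as `g` does at `y`.
      · have hout : ∃ w ∈ Ioo (z - ρ) (z + ρ), G w = 0 := by
          rcases le_or_gt y b with H | H
          · refine ⟨u, ⟨?_, by linarith [hz.1]⟩, hGu u le_rfl⟩
            have h1 := hbw z hz
            by_contra! hcon
            have h2 := mul_le_mul_of_nonneg_left hcon hσ0.le
            nlinarith [hy.1]
          · have H' : B ≤ y := by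
              by_contra! h; exact hyJ (hcover ⟨H, h⟩)
            refine ⟨v, ⟨by linarith [hz.2], ?_⟩, hGv v le_rfl⟩
            have h1 := hBw z hz
            by_contra! hcon
            have h2 := mul_le_mul_of_nonneg_left hcon hσ0.le
            nlinarith [hy.2]
        obtain ⟨w, hw, hw0⟩ := hout
        exact ⟨w, hw, by rw [hg0 y hyJ, hw0]; simp⟩
    have hcz : ENNReal.ofReal (deriv τ z) * ENNReal.ofReal (deriv τ z)⁻¹ = 1 := by
      rw [← ENNReal.ofReal_mul (hpos z hz).le, mul_inv_cancel₀ (hpos z hz).ne',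
        ENNReal.ofReal_one]
    calc _ ≤ ENNReal.ofReal (deriv τ z) * (ENNReal.ofReal (deriv τ z)⁻¹ *
        ((1 + ENNReal.ofReal (2 * c)) * O z + ENNReal.ofReal (2 * c) * ‖G z‖ₑ)) := by gcongr
      _ = _ := by rw [← mul_assoc, hcz, one_mul, hGz]
  have hsplit : ∫⁻ z, O z = (∫⁻ z in Iic u, O z) + (∫⁻ z in Ioo u v, O z) + ∫⁻ z in Ici v, O z := by
    rw [← lintegral_union measurableSet_Ioo (by
        rw [Set.disjoint_left]; intro z h1 h2; exact absurd h2.1 (not_lt.2 h1)),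
      Iic_union_Ioo_eq_Iio huv, ← lintegral_union measurableSet_Ici (by
        rw [Set.disjoint_left]; intro z h1 h2; exact absurd (mem_Iio.1 h1) (not_lt.2 h2)),
      Iio_union_Ici, Measure.restrict_univ]
  have hall : ∫⁻ x, oscIn univ g r x ≤ (∫⁻ x in Iic b, oscIn univ g r x) +
      (∫⁻ x in J, oscIn univ g r x) + ∫⁻ x in Ici B, oscIn univ g r x := by
    rw [← setLIntegral_univ]
    have hu : (univ : Set ℝ) ⊆ (Iic b ∪ J) ∪ Ici B := by
      intro x _
      rcases le_or_gt x b with H | H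
      · exact Or.inl (Or.inl H)
      · rcases le_or_gt B x with H' | H'
        · exact Or.inr H'
        · exact Or.inl (Or.inr (hcover ⟨H, H'⟩))
    refine (lintegral_mono_set hu).trans ((lintegral_union_le _ _ _).trans ?_)
    exact add_le_add_left (lintegral_union_le _ _ _) _
  refine hall.trans ?_
  calc _ ≤ (1 + ENNReal.ofReal (2 * c)) * (∫⁻ z in Iic u, O z) +
      ((1 + ENNReal.ofReal (2 * c)) * (∫⁻ z in Ioo u v, O z) +
        ENNReal.ofReal (2 * c) * ∫⁻ z in Ioo u v, ‖f z‖ₑ) +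
      (1 + ENNReal.ofReal (2 * c)) * (∫⁻ z in Ici v, O z) := by
        have h1 : ∀ a : ENNReal, a ≤ (1 + ENNReal.ofReal (2 * c)) * a := fun a =>
          le_mul_of_one_le_left zero_le le_self_add
        exact add_le_add (add_le_add (left.trans (h1 _)) inside) (right.trans (h1 _))
    _ = _ := by rw [hsplit]; ring


/-! ### Cutting a function off to an interval -/

lemma oscIn_indicator_le {S U : Set ℝ} (hSU : S ⊆ U) {f : ℝ → ℂ} {z ρ x R w : ℝ}
    (hsub : ∀ y ∈ Ioo (z - ρ) (z + ρ), y ∈ S → y ∈ Ioo (x - R) (x + R))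
    (hw : w ∈ Ioo (x - R) (x + R) ∩ U) :
    oscIn univ (S.indicator f) ρ z ≤ oscIn U f R x + ‖f w‖ₑ := by
  refine oscIn_le fun y₁ h₁ y₂ h₂ => ?_
  by_cases s₁ : y₁ ∈ S <;> by_cases s₂ : y₂ ∈ S
  · rw [indicator_of_mem s₁, indicator_of_mem s₂]
    exact (enorm_sub_le_oscIn ⟨hsub _ h₁.1 s₁, hSU s₁⟩ ⟨hsub _ h₂.1 s₂, hSU s₂⟩).trans le_self_add
  · rw [indicator_of_mem s₁, indicator_of_notMem s₂, sub_zero]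
    exact enorm_le_oscIn_add ⟨hsub _ h₁.1 s₁, hSU s₁⟩ hw
  · rw [indicator_of_notMem s₁, indicator_of_mem s₂, zero_sub, enorm_neg]
    exact enorm_le_oscIn_add ⟨hsub _ h₂.1 s₂, hSU s₂⟩ hw
  · simp [indicator_of_notMem s₁, indicator_of_notMem s₂]

lemma oscIn_mono_radius {U : Set ℝ} {f : ℝ → ℂ} {r r' x : ℝ} (h : r ≤ r') :
    oscIn U f r x ≤ oscIn U f r' x :=
  oscIn_le fun _ h₁ _ h₂ => enorm_sub_le_oscIn
    ⟨Ioo_subset_Ioo (by linarith) (by linarith) h₁.1, h₁.2⟩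
    ⟨Ioo_subset_Ioo (by linarith) (by linarith) h₂.1, h₂.2⟩

lemma setLIntegral_Ioo_add_le {a b c : ℝ} (hab : a ≤ b) (hbc : b ≤ c) (F : ℝ → ENNReal) :
    (∫⁻ t in Ioo a b, F t) + (∫⁻ t in Ioo b c, F t) ≤ ∫⁻ t in Ioo a c, F t := by
  rw [← lintegral_union measurableSet_Ioo]
  · exact lintegral_mono_set (union_subset (Ioo_subset_Ioo le_rfl hbc) (Ioo_subset_Ioo hab le_rfl))
  · rw [Set.disjoint_left]; intro t h₁ h₂; exact absurd (h₁.2.trans h₂.1) (lt_irrefl _)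

lemma setLIntegral_Ioo_affine {k : ℝ} (hk : 0 < k) (a b c : ℝ) (F : ℝ → ENNReal) :
    ∫⁻ z in Ioo (c + k * a) (c + k * b), F z =
      ENNReal.ofReal k * ∫⁻ t in Ioo a b, F (c + k * t) := by
  have himg : (fun z => c + k * z) '' Ioo a b = Ioo (c + k * a) (c + k * b) := by
    ext x; constructor
    · rintro ⟨z, hz, rfl⟩
      exact ⟨by nlinarith [hz.1], by nlinarith [hz.2]⟩
    · intro hx
      refine ⟨(x - c) / k, ⟨?_, ?_⟩, by field_simp; ring⟩
      · rw [lt_div_iff₀ hk]; linarith [hx.1]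
      · rw [div_lt_iff₀ hk]; linarith [hx.2]
  rw [← himg, setLIntegral_image_affine _ measurableSet_Ioo _ _ hk.ne', abs_of_pos hk]

lemma setLIntegral_Ioo_reflect (a b c : ℝ) (F : ℝ → ENNReal) :
    ∫⁻ z in Ioo (c - b) (c - a), F z = ∫⁻ t in Ioo a b, F (c - t) := by
  have himg : (fun z => c + (-1) * z) '' Ioo a b = Ioo (c - b) (c - a) := by
    ext x; constructor
    · rintro ⟨z, hz, rfl⟩
      exact ⟨by linarith [hz.2], by linarith [hz.1]⟩
    · intro hx
      exact ⟨c - x, ⟨by linarith [hx.2], by linarith [hx.1]⟩, by ring⟩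
  rw [← himg, setLIntegral_image_affine _ measurableSet_Ioo _ _ (by norm_num)]
  simp [sub_eq_add_neg]

lemma setLIntegral_Ioo_translate (a b c : ℝ) (F : ℝ → ENNReal) :
    ∫⁻ z in Ioo (c + a) (c + b), F z = ∫⁻ t in Ioo a b, F (c + t) := by
  simpa using setLIntegral_Ioo_affine one_pos a b c F

/-- A bound of the variation of `f · χ_(u,v)` by bounds away from the endpoints and near them. -/
lemma lintegral_oscIn_indicator_le {u v ρ L : ℝ} {f : ℝ → ℂ} {X Y : ℝ → ENNReal} {c : ENNReal}
    (hρ : 0 < ρ) (hρL : ρ ≤ L) (hL : 2 * L ≤ v - u)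
    (core : ∀ z ∈ Ioo (u + ρ) (v - ρ), oscIn univ ((Ioo u v).indicator f) ρ z ≤ X z)
    (left : ∫⁻ t in Ioo 0 ρ, (oscIn univ ((Ioo u v).indicator f) ρ (u - 1 * t) +
        oscIn univ ((Ioo u v).indicator f) ρ (u + 1 * t)) ≤
      (∫⁻ t in Ioo 0 ρ, X (u + 1 * t)) + c * ∫⁻ t in Ioo 0 L, Y (u + 1 * t))
    (right : ∫⁻ t in Ioo 0 ρ, (oscIn univ ((Ioo u v).indicator f) ρ (v - (-1) * t) +
        oscIn univ ((Ioo u v).indicator f) ρ (v + (-1) * t)) ≤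
      (∫⁻ t in Ioo 0 ρ, X (v + (-1) * t)) + c * ∫⁻ t in Ioo 0 L, Y (v + (-1) * t)) :
    ∫⁻ z, oscIn univ ((Ioo u v).indicator f) ρ z ≤
      (∫⁻ z in Ioo u v, X z) + c * ∫⁻ z in Ioo u v, Y z := by
  set O := fun z => oscIn univ ((Ioo u v).indicator f) ρ z with hO
  have hOm : Measurable O := measurable_oscIn _ _ _
  have ht : ∀ F : ℝ → ENNReal, ∀ b, ∫⁻ t in Ioo 0 b, F (u + 1 * t) = ∫⁻ z in Ioo u (u + b), F z := by
    intro F b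
    have := setLIntegral_Ioo_translate 0 b u F
    rw [add_zero] at this
    rw [this]; simp
  have hr : ∀ F : ℝ → ENNReal, ∀ b,
      ∫⁻ t in Ioo 0 b, F (v + (-1) * t) = ∫⁻ z in Ioo (v - b) v, F z := by
    intro F b
    have := setLIntegral_Ioo_reflect 0 b v F
    rw [sub_zero] at this
    rw [this]; simp [sub_eq_add_neg]
  have hl' : ∫⁻ t in Ioo 0 ρ, O (u - 1 * t) = ∫⁻ z in Ioo (u - ρ) u, O z := by
    have := setLIntegral_Ioo_reflect 0 ρ u O
    rw [sub_zero] at this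
    rw [this]; simp
  have hr' : ∫⁻ t in Ioo 0 ρ, O (v - (-1) * t) = ∫⁻ z in Ioo v (v + ρ), O z := by
    have := setLIntegral_Ioo_translate 0 ρ v O
    rw [add_zero] at this
    rw [this]; simp
  replace left := (lintegral_add_left (f := fun t => O (u - 1 * t)) (hOm.comp (by fun_prop))
    fun t => O (u + 1 * t)).symm.trans_le left
  replace right := (lintegral_add_left (f := fun t => O (v - (-1) * t)) (hOm.comp (by fun_prop))
    fun t => O (v + (-1) * t)).symm.trans_le right
  rw [hl', ht, ht, ht] at left
  rw [hr', hr, hr, hr] at right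
  have h0 : ∀ z, z ∉ Ioo (u - ρ) (v + ρ) → O z = 0 := by
    intro z hz
    refine le_antisymm (oscIn_le fun y₁ h₁ y₂ h₂ => ?_) zero_le
    have hn : ∀ y ∈ Ioo (z - ρ) (z + ρ), y ∉ Ioo u v := fun y hy hy' =>
      hz ⟨by linarith [hy.2, hy'.1], by linarith [hy.1, hy'.2]⟩
    simp [indicator_of_notMem (hn _ h₁.1), indicator_of_notMem (hn _ h₂.1)]
  have hcov : ∫⁻ z, O z ≤ (∫⁻ z in Ioo (u - ρ) u, O z) + (∫⁻ z in Ioo u (u + ρ), O z) +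
      (∫⁻ z in Ioo (u + ρ) (v - ρ), O z) + ((∫⁻ z in Ioo (v - ρ) v, O z) +
      ∫⁻ z in Ioo v (v + ρ), O z) := by
    have hfin : (∫⁻ z in ({u, u + ρ, v - ρ, v} : Set ℝ), O z) = 0 :=
      setLIntegral_measure_zero _ _ ((Set.toFinite _).measure_zero _)
    have hsub : Ioo (u - ρ) (v + ρ) ⊆ (((Ioo (u - ρ) u ∪ Ioo u (u + ρ)) ∪ Ioo (u + ρ) (v - ρ)) ∪
        (Ioo (v - ρ) v ∪ Ioo v (v + ρ))) ∪ {u, u + ρ, v - ρ, v} := by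
      intro z hz
      simp only [mem_union, mem_Ioo, mem_insert_iff, mem_singleton_iff]
      have := hz.1; have := hz.2
      rcases lt_trichotomy z u with h | h | h <;>
      rcases lt_trichotomy z (u + ρ) with h' | h' | h' <;>
      rcases lt_trichotomy z (v - ρ) with h'' | h'' | h'' <;>
      rcases lt_trichotomy z v with h₃ | h₃ | h₃ <;> first | (exfalso; linarith) | tauto
    calc ∫⁻ z, O z = ∫⁻ z in Ioo (u - ρ) (v + ρ), O z := by
          refine (setLIntegral_eq_of_support_subset ?_).symm
          intro z hz; by_contra h; exact hz (h0 z h)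
      _ ≤ _ := lintegral_mono_set hsub
      _ ≤ _ := (lintegral_union_le _ _ _).trans (by
          rw [hfin, add_zero]
          refine (lintegral_union_le _ _ _).trans
            (add_le_add ((lintegral_union_le _ _ _).trans ?_) (lintegral_union_le _ _ _))
          exact add_le_add_left (lintegral_union_le _ _ _) _)
  have hcore : ∫⁻ z in Ioo (u + ρ) (v - ρ), O z ≤ ∫⁻ z in Ioo (u + ρ) (v - ρ), X z :=
    setLIntegral_mono' measurableSet_Ioo core
  have hX : (∫⁻ z in Ioo u (u + ρ), X z) + (∫⁻ z in Ioo (u + ρ) (v - ρ), X z) +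
      (∫⁻ z in Ioo (v - ρ) v, X z) ≤ ∫⁻ z in Ioo u v, X z :=
    (add_le_add_left (setLIntegral_Ioo_add_le (by linarith) (by linarith) X) _).trans
      (setLIntegral_Ioo_add_le (by linarith) (by linarith) X)
  -- Because `2 * L ≤ v - u`, the two endpoint layers are disjoint and `Y` is integrated over the
  -- interval only once.
  have hY : (∫⁻ z in Ioo u (u + L), Y z) + (∫⁻ z in Ioo (v - L) v, Y z) ≤ ∫⁻ z in Ioo u v, Y z :=
    (add_le_add_left (lintegral_mono_set (Ioo_subset_Ioo le_rfl (by linarith))) _).trans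
      (setLIntegral_Ioo_add_le (b := v - L) (by linarith) (by linarith) Y)
  calc ∫⁻ z, O z ≤ _ := hcov
    _ ≤ ((∫⁻ z in Ioo u (u + ρ), X z) + c * ∫⁻ z in Ioo u (u + L), Y z) +
        (∫⁻ z in Ioo (u + ρ) (v - ρ), X z) +
        ((∫⁻ z in Ioo (v - ρ) v, X z) + c * ∫⁻ z in Ioo (v - L) v, Y z) :=
      add_le_add (add_le_add left hcore) (by rw [add_comm]; exact right)
    _ = ((∫⁻ z in Ioo u (u + ρ), X z) + (∫⁻ z in Ioo (u + ρ) (v - ρ), X z) +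
        (∫⁻ z in Ioo (v - ρ) v, X z)) +
        c * ((∫⁻ z in Ioo u (u + L), Y z) + ∫⁻ z in Ioo (v - L) v, Y z) := by ring
    _ ≤ _ := by gcongr

/-! ### Boundary layers: dilation and chains of windows -/

section Endpoint

variable {S U : Set ℝ} {f : ℝ → ℂ} {H : ℝ → ENNReal} {e d : ℝ}

lemma oscIn_indicator_inner_le (hSU : S ⊆ U) (hH : ∀ x ∈ U, ‖f x‖ₑ ≤ H x) {ρ z : ℝ}
    (hρ : 0 < ρ) (hz : z ∈ U) :
    oscIn univ (S.indicator f) ρ z ≤ oscIn U f ρ z + H z :=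
  (oscIn_indicator_le hSU (fun _ h _ => h) ⟨⟨by linarith, by linarith⟩, hz⟩).trans
    (add_le_add_right (hH _ hz) _)

/-- Near an endpoint the oscillation of `f · χ_S` is bounded by that of `f` at a larger scale. -/
lemma oscIn_indicator_endpoint_le (hSU : S ⊆ U) (hH : ∀ x ∈ U, ‖f x‖ₑ ≤ H x)
    (hd : d = 1 ∨ d = -1) (hpos : ∀ w ∈ S, 0 < d * (w - e)) {ρ lam t : ℝ}
    (hlam : 1 ≤ lam) (ht : t ∈ Ioo 0 ρ) (hin : e + d * (lam * t) ∈ U) :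
    oscIn univ (S.indicator f) ρ (e - d * t) ≤
        oscIn U f (lam * ρ) (e + d * (lam * t)) + H (e + d * (lam * t)) ∧
      oscIn univ (S.indicator f) ρ (e + d * t) ≤
        oscIn U f (lam * ρ) (e + d * (lam * t)) + H (e + d * (lam * t)) := by
  have h1 : t ≤ lam * t := by nlinarith [ht.1]
  have h2 : lam * t < lam * ρ := by nlinarith [ht.2]
  have h3 : ρ - t ≤ lam * ρ - lam * t := by nlinarith [ht.2]
  have hself : e + d * (lam * t) ∈ Ioo (e + d * (lam * t) - lam * ρ)
      (e + d * (lam * t) + lam * ρ) ∩ U := by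
    have := ht.1
    exact ⟨⟨by linarith, by linarith⟩, hin⟩
  have := ht.1
  have := ht.2
  constructor
  · refine (oscIn_indicator_le hSU (fun y hy hyS => ?_) hself).trans (add_le_add_right (hH _ hin) _)
    have h4 := hpos y hyS
    have h5 := hy.1
    have h6 := hy.2
    rcases hd with rfl | rfl <;> constructor <;> linarith
  · refine (oscIn_indicator_le hSU (fun y hy hyS => ?_) hself).trans (add_le_add_right (hH _ hin) _)
    have h4 := hpos y hyS
    have h5 := hy.1
    have h6 := hy.2
    rcases hd with rfl | rfl <;> constructor <;> linarith

lemma setLIntegral_endpoint_scale {lam ρ : ℝ} (hlam : 0 < lam) (Y : ℝ → ENNReal) :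
    ∫⁻ t in Ioo 0 ρ, Y (e + d * (lam * t)) =
      ENNReal.ofReal lam⁻¹ * ∫⁻ t in Ioo 0 (lam * ρ), Y (e + d * t) := by
  have := setLIntegral_Ioo_affine hlam 0 ρ 0 (fun t => Y (e + d * t))
  simp only [zero_add, mul_zero] at this
  rw [this, ← mul_assoc, ← ENNReal.ofReal_mul (inv_pos.2 hlam).le, inv_mul_cancel₀ hlam.ne',
    ENNReal.ofReal_one, one_mul]

/-- The value at the beginning of a chain of windows is bounded by the oscillations along the
chain and the mean of the values. -/
lemma enorm_le_chain (hH : ∀ x ∈ U, ‖f x‖ₑ ≤ H x) (hd : d = 1 ∨ d = -1) {b ρ ρ' : ℝ}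
    (hρ : 0 < ρ) (hρ' : ρ < ρ') {N : ℕ} (hN : 0 < N)
    (hin : ∀ s, 0 ≤ s → s < 2 * N * ρ → b + d * s ∈ U) :
    ‖f b‖ₑ ≤ ∑ j ∈ Finset.range N, (oscIn U f ρ' (b + d * ((2 * j + 1) * ρ)) +
      H (b + d * ((2 * j + 1) * ρ)) / N) := by
  set Q := fun j : ℕ => oscIn U f ρ' (b + d * ((2 * j + 1) * ρ)) with hQ
  have hy : ∀ j : ℕ, j < N → b + d * (2 * j * ρ) ∈ U := fun j hj => by
    have : (j : ℝ) < N := by exact_mod_cast hj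
    exact hin _ (by positivity) (by nlinarith)
  have hc : ∀ j : ℕ, j < N → b + d * ((2 * j + 1) * ρ) ∈ U := fun j hj => by
    have : (j : ℝ) + 1 ≤ N := by exact_mod_cast hj
    exact hin _ (by positivity) (by nlinarith)
  -- Consecutive points of the chain lie at distance exactly `ρ` from the centre between them; `ρ <
  -- ρ'` puts them in the open window.
  have hwin : ∀ s s' : ℝ, |s - s'| ≤ ρ → b + d * s ∈ Ioo (b + d * s' - ρ') (b + d * s' + ρ') := by
    intro s s' h
    have := abs_le.1 h
    rcases hd with rfl | rfl <;> constructor <;> linarith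
  have hstart : ∀ n : ℕ, n < N →
      ‖f b‖ₑ ≤ (∑ j ∈ Finset.range n, Q j) + ‖f (b + d * (2 * n * ρ))‖ₑ := by
    intro n
    induction n with
    | zero => intro _; simp
    | succ n ih =>
      intro hn
      have hn' : n < N := by omega
      refine (ih hn').trans ?_
      rw [Finset.sum_range_succ, add_assoc]
      refine add_le_add_right (enorm_le_oscIn_add ⟨hwin _ _ ?_, hy n hn'⟩
        ⟨hwin _ _ ?_, hy (n + 1) hn⟩) _
      · rw [abs_le]; constructor <;> linarith
      · push_cast; rw [abs_le]; constructor <;> linarith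
  have hbound : ∀ n ∈ Finset.range N, ‖f b‖ₑ ≤ (∑ j ∈ Finset.range N, Q j) +
      H (b + d * ((2 * n + 1) * ρ)) := by
    intro n hn
    rw [Finset.mem_range] at hn
    refine (hstart n hn).trans ?_
    calc _ ≤ (∑ j ∈ Finset.range n, Q j) + (Q n + H (b + d * ((2 * n + 1) * ρ))) := by
          refine add_le_add_right ((enorm_le_oscIn_add ⟨hwin _ _ ?_, hy n hn⟩
            ⟨hwin _ _ ?_, hc n hn⟩).trans (add_le_add_right (hH _ (hc n hn)) _)) _
          · rw [abs_le]; constructor <;> linarith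
          · rw [sub_self, abs_zero]; exact hρ.le
      _ = (∑ j ∈ Finset.range (n + 1), Q j) + H (b + d * ((2 * n + 1) * ρ)) := by
          rw [Finset.sum_range_succ, add_assoc]
      _ ≤ _ := by
          gcongr
          omega
  -- The chain may stop at any of its `N` centres. Averaging these bounds keeps the sum of
  -- oscillations and replaces `H` by its mean over the centres.
  have hsum := Finset.sum_le_sum hbound
  rw [Finset.sum_const, Finset.sum_add_distrib, Finset.sum_const, Finset.card_range,
    nsmul_eq_mul, nsmul_eq_mul] at hsum
  have hN0 : (N : ENNReal) ≠ 0 := by exact_mod_cast hN.ne'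
  have hNt : (N : ENNReal) ≠ ⊤ := ENNReal.natCast_ne_top N
  have h := mul_le_mul_right hsum (N : ENNReal)⁻¹
  rw [mul_add, ← mul_assoc, ← mul_assoc, ENNReal.inv_mul_cancel hN0 hNt, one_mul, one_mul] at h
  refine h.trans (le_of_eq ?_)
  rw [Finset.sum_add_distrib, Finset.mul_sum]
  simp only [ENNReal.div_eq_inv_mul, hQ]

/-- As `t` runs over `(0, ρ)`, the points `t` and `(2j+2)ρ ± t` sweep out disjoint intervals of
length `ρ` in `(0, (2N+1)ρ)`. -/
lemma chain_lintegral_le (F : ℝ → ENNReal) {ρ : ℝ} (hρ : 0 ≤ ρ) (N : ℕ) :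
    (∫⁻ t in Ioo 0 ρ, F t) + ∑ j ∈ Finset.range N, ((∫⁻ t in Ioo 0 ρ, F ((2 * j + 2) * ρ - t)) +
      ∫⁻ t in Ioo 0 ρ, F ((2 * j + 2) * ρ + t)) ≤ ∫⁻ t in Ioo 0 ((2 * N + 1) * ρ), F t := by
  induction N with
  | zero => simp
  | succ n ih =>
    rw [Finset.sum_range_succ, ← add_assoc]
    have h1 : ∫⁻ t in Ioo 0 ρ, F ((2 * n + 2) * ρ - t) =
        ∫⁻ t in Ioo ((2 * n + 1) * ρ) ((2 * n + 2) * ρ), F t := by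
      rw [← setLIntegral_Ioo_reflect]; congr 3 <;> ring
    have h2 : ∫⁻ t in Ioo 0 ρ, F ((2 * n + 2) * ρ + t) =
        ∫⁻ t in Ioo ((2 * n + 2) * ρ) ((2 * (n + 1 : ℕ) + 1) * ρ), F t := by
      rw [← setLIntegral_Ioo_translate]; push_cast; congr 3 <;> ring
    rw [h1, h2]
    refine (add_le_add_left ih _).trans ?_
    rw [← add_assoc]
    refine (add_le_add_left (setLIntegral_Ioo_add_le (by positivity) (by nlinarith) F) _).trans ?_
    exact setLIntegral_Ioo_add_le (by positivity) (by push_cast; nlinarith) F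

/-- The points at distance `t` on either side of `e` are both compared with the inner one. The jump
to zero is charged to `f` at distances `ρ - t` and `ρ + t` from `e`, and chains from these two
points have centres at distances `(2j+2)ρ ± t`. Together with one copy at `t` the centres tile, so
only the first layer is counted twice. -/
lemma oscIn_endpoint_chain_le (hSU : S ⊆ U) (hH : ∀ x ∈ U, ‖f x‖ₑ ≤ H x) (hHm : Measurable H)
    (hd : d = 1 ∨ d = -1) (hpos : ∀ w ∈ S, 0 < d * (w - e)) {ρ ρ' : ℝ}
    (hρ : 0 < ρ) (hρ' : ρ < ρ') {N : ℕ} (hN : 0 < N)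
    (hin : ∀ s, 0 < s → s < (2 * N + 2) * ρ → e + d * s ∈ U) :
    ∫⁻ t in Ioo 0 ρ, (oscIn univ (S.indicator f) ρ (e - d * t) +
        oscIn univ (S.indicator f) ρ (e + d * t)) ≤
      (∫⁻ t in Ioo 0 ρ, oscIn U f ρ' (e + d * t)) +
        1 * ∫⁻ t in Ioo 0 ((2 * N + 1) * ρ), (oscIn U f ρ' (e + d * t) + H (e + d * t) / N) := by
  set Q := fun t => oscIn U f ρ' (e + d * t) + H (e + d * t) / N with hQ
  have hoscm : Measurable fun t => oscIn U f ρ' (e + d * t) :=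
    (measurable_oscIn U f ρ').comp (by fun_prop)
  have hQm : Measurable Q := hoscm.add ((hHm.comp (by fun_prop)).div_const _)
  have hpt : ∀ t ∈ Ioo 0 ρ, oscIn univ (S.indicator f) ρ (e - d * t) +
      oscIn univ (S.indicator f) ρ (e + d * t) ≤ oscIn U f ρ' (e + d * t) + (Q t +
        ∑ j ∈ Finset.range N, (Q ((2 * j + 2) * ρ - t) + Q ((2 * j + 2) * ρ + t))) := by
    intro t ht
    have ht1 := ht.1
    have ht2 := ht.2
    have hNρ : 0 ≤ (N : ℝ) * ρ := by positivity
    have chain : ∀ σ : ℝ, 0 < σ → σ < 2 * ρ → ‖f (e + d * σ)‖ₑ ≤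
        ∑ j ∈ Finset.range N, Q (σ + (2 * j + 1) * ρ) := by
      intro σ h0 h2
      have := enorm_le_chain (U := U) (b := e + d * σ) hH hd hρ hρ' hN (fun s hs hs' => by
        have := hin (σ + s) (by linarith) (by linarith)
        rwa [mul_add, ← add_assoc] at this)
      refine this.trans (le_of_eq (Finset.sum_congr rfl fun j _ => ?_))
      simp only [hQ, mul_add, add_assoc]
    have b1 : oscIn univ (S.indicator f) ρ (e - d * t) ≤
        oscIn U f ρ' (e + d * t) + ‖f (e + d * (ρ - t))‖ₑ := by
      refine oscIn_indicator_le hSU (fun y hy hyS => ?_) ⟨?_, hin _ (by linarith) (by nlinarith)⟩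
      · have h4 := hpos y hyS
        have h5 := hy.1
        have h6 := hy.2
        rcases hd with rfl | rfl <;> constructor <;> linarith
      · rcases hd with rfl | rfl <;> constructor <;> linarith
    have b2 : oscIn univ (S.indicator f) ρ (e + d * t) ≤
        oscIn U f ρ' (e + d * t) + ‖f (e + d * (ρ + t))‖ₑ := by
      have hN1 : (1 : ℝ) ≤ N := by exact_mod_cast hN
      refine oscIn_indicator_le hSU (fun y hy hyS => ?_) ⟨?_, hin _ (by linarith) (by nlinarith)⟩
      · have h5 := hy.1
        have h6 := hy.2
        constructor <;> linarith
      · rcases hd with rfl | rfl <;> constructor <;> linarith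
    refine (add_le_add b1 b2).trans ?_
    have c1 := chain (ρ - t) (by linarith) (by linarith)
    have c2 := chain (ρ + t) (by linarith) (by linarith)
    calc _ ≤ (oscIn U f ρ' (e + d * t) + ∑ j ∈ Finset.range N, Q (ρ - t + (2 * j + 1) * ρ)) +
          (oscIn U f ρ' (e + d * t) + ∑ j ∈ Finset.range N, Q (ρ + t + (2 * j + 1) * ρ)) := by
          gcongr
      _ = oscIn U f ρ' (e + d * t) + (oscIn U f ρ' (e + d * t) +
          ∑ j ∈ Finset.range N, (Q ((2 * j + 2) * ρ - t) + Q ((2 * j + 2) * ρ + t))) := by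
          rw [Finset.sum_add_distrib (f := fun j : ℕ => Q ((2 * j + 2) * ρ - t))]
          have e1 : ∀ j : ℕ, ρ - t + (2 * j + 1) * ρ = (2 * j + 2) * ρ - t := fun j => by ring
          have e2 : ∀ j : ℕ, ρ + t + (2 * j + 1) * ρ = (2 * j + 2) * ρ + t := fun j => by ring
          simp only [e1, e2]
          ring
      _ ≤ _ := by
          gcongr
          exact le_self_add
  refine (setLIntegral_mono' measurableSet_Ioo hpt).trans ?_
  rw [lintegral_add_left hoscm, lintegral_add_left hQm, lintegral_finsetSum, one_mul]
  · refine add_le_add_right (le_trans (le_of_eq ?_) (chain_lintegral_le Q hρ.le N)) _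
    congr 1
    refine Finset.sum_congr rfl fun j _ => ?_
    exact lintegral_add_left (hQm.comp (by fun_prop)) _
  · intro j _
    exact (hQm.comp (by fun_prop)).add (hQm.comp (by fun_prop))

end Endpoint


/-! ### Three bounds for a single interval -/

section Branch

variable {U : Set ℝ} {f : ℝ → ℂ} {H : ℝ → ENNReal} {u v : ℝ}

/-- Only the layer outside the interval is dilated; inside, `H` pays for the jump. This gives the
factor `ρ / R` once, at the price of a term in `H` that does not become small with `ρ`. -/
lemma lintegral_branch_le_inner (hSU : Ioo u v ⊆ U) (hH : ∀ x ∈ U, ‖f x‖ₑ ≤ H x)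
    (hHm : Measurable H) {ρ R : ℝ} (hρ : 0 < ρ) (hρR : ρ ≤ R) (hR : 2 * R ≤ v - u) :
    ∫⁻ z, oscIn univ ((Ioo u v).indicator f) ρ z ≤
      (∫⁻ z in Ioo u v, (oscIn U f ρ z + H z)) +
        ENNReal.ofReal (ρ / R) * ∫⁻ z in Ioo u v, (oscIn U f R z + H z) := by
  have hlam : 1 ≤ R / ρ := (one_le_div hρ).2 hρR
  have hlρ : R / ρ * ρ = R := div_mul_cancel₀ _ hρ.ne'
  have hend : ∀ e d : ℝ, d = 1 ∨ d = -1 → (∀ w ∈ Ioo u v, 0 < d * (w - e)) →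
      (∀ t ∈ Ioo 0 R, e + d * t ∈ Ioo u v) →
      ∫⁻ t in Ioo 0 ρ, (oscIn univ ((Ioo u v).indicator f) ρ (e - d * t) +
        oscIn univ ((Ioo u v).indicator f) ρ (e + d * t)) ≤
      (∫⁻ t in Ioo 0 ρ, (oscIn U f ρ (e + d * t) + H (e + d * t))) +
        ENNReal.ofReal (ρ / R) *
          ∫⁻ t in Ioo 0 R, (oscIn U f R (e + d * t) + H (e + d * t)) := by
    intro e d hd hpos hin
    have hsc := setLIntegral_endpoint_scale (e := e) (d := d) (ρ := ρ) (by linarith : 0 < R / ρ)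
      (fun z => oscIn U f R z + H z)
    rw [hlρ, inv_div] at hsc
    rw [← hsc, ← lintegral_add_left (f := fun t => oscIn U f ρ (e + d * t) + H (e + d * t))
      (((measurable_oscIn U f ρ).comp (by fun_prop)).add (hHm.comp (by fun_prop)))]
    refine setLIntegral_mono' measurableSet_Ioo fun t ht => ?_
    have hlt : R / ρ * t ∈ Ioo 0 R := ⟨mul_pos (by linarith) ht.1, by
      calc _ < R / ρ * ρ := by gcongr; exact ht.2
        _ = R := hlρ⟩
    have h := (oscIn_indicator_endpoint_le hSU hH hd hpos hlam ht (hSU (hin _ hlt))).1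
    rw [hlρ] at h
    rw [add_comm]
    exact add_le_add (oscIn_indicator_inner_le hSU hH hρ
      (hSU (hin t ⟨ht.1, ht.2.trans_le hρR⟩))) h
  refine lintegral_oscIn_indicator_le hρ hρR hR (fun z hz => ?_)
    (hend u 1 (Or.inl rfl) (fun w hw => by linarith [hw.1])
      (fun t ht => ⟨by linarith [ht.1], by linarith [ht.1, ht.2]⟩))
    (hend v (-1) (Or.inr rfl) (fun w hw => by linarith [hw.2])
      (fun t ht => ⟨by linarith [ht.1, ht.2], by linarith [ht.1]⟩))
  exact oscIn_indicator_inner_le hSU hH hρ (hSU ⟨by linarith [hz.1], by linarith [hz.2]⟩)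

lemma oscIn_indicator_core_le (hSU : Ioo u v ⊆ U) {ρ z : ℝ} (hz : z ∈ Ioo (u + ρ) (v - ρ)) :
    oscIn univ ((Ioo u v).indicator f) ρ z ≤ oscIn U f ρ z := by
  have hm : ∀ y ∈ Ioo (z - ρ) (z + ρ), y ∈ Ioo u v := fun y hy =>
    ⟨by linarith [hz.1, hy.1], by linarith [hz.2, hy.2]⟩
  refine oscIn_le fun y₁ h₁ y₂ h₂ => ?_
  rw [indicator_of_mem (hm _ h₁.1), indicator_of_mem (hm _ h₂.1)]
  exact enorm_sub_le_oscIn ⟨h₁.1, hSU (hm _ h₁.1)⟩ ⟨h₂.1, hSU (hm _ h₂.1)⟩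

/-- Both sides of each endpoint are dilated inward. The factor becomes `2 * ρ / R`, but every
occurrence of `H` now carries it. -/
lemma lintegral_branch_le_double (hSU : Ioo u v ⊆ U) (hH : ∀ x ∈ U, ‖f x‖ₑ ≤ H x)
    {ρ R : ℝ} (hρ : 0 < ρ) (hρR : ρ ≤ R) (hR : 2 * R ≤ v - u) :
    ∫⁻ z, oscIn univ ((Ioo u v).indicator f) ρ z ≤
      (∫⁻ z in Ioo u v, oscIn U f ρ z) +
        (2 * ENNReal.ofReal (ρ / R)) * ∫⁻ z in Ioo u v, (oscIn U f R z + H z) := by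
  have hlam : 1 ≤ R / ρ := (one_le_div hρ).2 hρR
  have hlρ : R / ρ * ρ = R := div_mul_cancel₀ _ hρ.ne'
  have hend : ∀ e d : ℝ, d = 1 ∨ d = -1 → (∀ w ∈ Ioo u v, 0 < d * (w - e)) →
      (∀ t ∈ Ioo 0 R, e + d * t ∈ Ioo u v) →
      ∫⁻ t in Ioo 0 ρ, (oscIn univ ((Ioo u v).indicator f) ρ (e - d * t) +
        oscIn univ ((Ioo u v).indicator f) ρ (e + d * t)) ≤
      (∫⁻ t in Ioo 0 ρ, oscIn U f ρ (e + d * t)) +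
        (2 * ENNReal.ofReal (ρ / R)) *
          ∫⁻ t in Ioo 0 R, (oscIn U f R (e + d * t) + H (e + d * t)) := by
    intro e d hd hpos hin
    have hsc := setLIntegral_endpoint_scale (e := e) (d := d) (ρ := ρ) (by linarith : 0 < R / ρ)
      (fun z => oscIn U f R z + H z)
    rw [hlρ, inv_div] at hsc
    rw [mul_assoc, ← hsc, ← lintegral_const_mul' _ _ (by simp)]
    refine le_trans (setLIntegral_mono' measurableSet_Ioo fun t ht => ?_) le_add_self
    have hlt : R / ρ * t ∈ Ioo 0 R := ⟨mul_pos (by linarith) ht.1, by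
      calc _ < R / ρ * ρ := by gcongr; exact ht.2
        _ = R := hlρ⟩
    have h := oscIn_indicator_endpoint_le hSU hH hd hpos hlam ht (hSU (hin _ hlt))
    rw [hlρ] at h
    rw [two_mul]
    exact add_le_add h.1 h.2
  exact lintegral_oscIn_indicator_le hρ hρR hR (fun z hz => oscIn_indicator_core_le hSU hz)
    (hend u 1 (Or.inl rfl) (fun w hw => by linarith [hw.1])
      (fun t ht => ⟨by linarith [ht.1], by linarith [ht.1, ht.2]⟩))
    (hend v (-1) (Or.inr rfl) (fun w hw => by linarith [hw.2])
      (fun t ht => ⟨by linarith [ht.1, ht.2], by linarith [ht.1]⟩))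

/-- The two chain estimates fit into the interval without overlap, giving two oscillation integrals
at scale `ρ'` and only a fraction `1 / N` of the mass. -/
lemma lintegral_branch_le_chain (hSU : Ioo u v ⊆ U) (hH : ∀ x ∈ U, ‖f x‖ₑ ≤ H x)
    (hHm : Measurable H) {ρ ρ' : ℝ} (hρ : 0 < ρ) (hρ' : ρ < ρ') {N : ℕ} (hN : 0 < N)
    (hNρ : 2 * ((2 * N + 2) * ρ) ≤ v - u) :
    ∫⁻ z, oscIn univ ((Ioo u v).indicator f) ρ z ≤
      (∫⁻ z in Ioo u v, oscIn U f ρ' z) +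
        1 * ∫⁻ z in Ioo u v, (oscIn U f ρ' z + H z / N) := by
  have hN0 : 0 ≤ (N : ℝ) * ρ := by positivity
  exact lintegral_oscIn_indicator_le (L := (2 * N + 1) * ρ) hρ (by linarith) (by linarith)
    (fun z hz => (oscIn_indicator_core_le hSU hz).trans (oscIn_mono_radius hρ'.le))
    (oscIn_endpoint_chain_le hSU hH hHm (Or.inl rfl) (fun w hw => by linarith [hw.1]) hρ hρ' hN
      (fun t h1 h2 => hSU ⟨by linarith, by linarith⟩))
    (oscIn_endpoint_chain_le hSU hH hHm (Or.inr rfl) (fun w hw => by linarith [hw.2]) hρ hρ' hN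
      (fun t h1 h2 => hSU ⟨by linarith, by linarith⟩))

end Branch

/-! ### Summation over the partition and choice of constants -/

section Partition

variable {q : ℕ} {a : Fin (q + 1) → ℝ}

lemma piece_subset (ha : StrictMono a) (h0 : a 0 = 0) (h1 : a (Fin.last q) = 1) (i : Fin q) :
    piece a i ⊆ Icc 0 1 := by
  intro x hx
  have h2 : a 0 ≤ a i.castSucc := ha.monotone (Fin.zero_le _)
  have h3 : a i.succ ≤ a (Fin.last q) := ha.monotone (Fin.le_last _)
  exact ⟨by linarith [hx.1], by linarith [hx.2]⟩

lemma pairwise_disjoint_piece (ha : StrictMono a) :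
    Pairwise (fun i j => Disjoint (piece a i) (piece a j)) := by
  have key : ∀ i j : Fin q, i < j → Disjoint (piece a i) (piece a j) := by
    intro i j hij
    rw [Set.disjoint_left]
    intro x hx hy
    have : a i.succ ≤ a j.castSucc := ha.monotone (by
      rw [Fin.le_def]; simp only [Fin.val_succ, Fin.val_castSucc]; exact hij)
    linarith [hx.2, hy.1]
  intro i j hij
  rcases lt_or_gt_of_ne hij with h | h
  · exact key i j h
  · exact (key j i h).symm

lemma sum_lintegral_piece_le (ha : StrictMono a) (h0 : a 0 = 0) (h1 : a (Fin.last q) = 1)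
    (F : ℝ → ENNReal) : ∑ i, ∫⁻ z in piece a i, F z ≤ ∫⁻ z, F z ∂mI := by
  have := lintegral_iUnion (μ := volume) (fun i => (measurableSet_Ioo : MeasurableSet (piece a i)))
    (pairwise_disjoint_piece ha) F
  rw [tsum_fintype] at this
  refine this.symm.trans_le ?_
  exact lintegral_mono_set (iUnion_subset fun i => piece_subset ha h0 h1 i)

lemma exists_gap (ha : StrictMono a) :
    ∃ γ : ℝ, 0 < γ ∧ ∀ i : Fin q, γ ≤ a i.succ - a i.castSucc := by
  rcases Nat.eq_zero_or_pos q with rfl | hq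
  · exact ⟨1, one_pos, fun i => i.elim0⟩
  · have : Nonempty (Fin q) := ⟨⟨0, hq⟩⟩
    obtain ⟨i, hi⟩ := Finite.exists_min (fun i : Fin q => a i.succ - a i.castSucc)
    exact ⟨_, sub_pos.2 (ha (by rw [Fin.lt_def]; simp)), hi⟩

lemma oscOne_le {A p r : ℝ} (f : ℝ → ℂ) (hr : 0 < r) (hrA : r ≤ A) :
    oscOne f r ≤ ENNReal.ofReal (r ^ (1 / p)) * varFun A p f := by
  have h : oscOne f r / ENNReal.ofReal (r ^ (1 / p)) ≤ varFun A p f :=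
    le_iSup₂ (f := fun r (_ : r ∈ Ioc (0 : ℝ) A) => oscOne f r / ENNReal.ofReal (r ^ (1 / p))) r
      ⟨hr, hrA⟩
  rw [mul_comm]
  refine (ENNReal.div_le_iff ?_ ENNReal.ofReal_ne_top).1 h
  exact (ENNReal.ofReal_pos.2 (Real.rpow_pos_of_pos hr _)).ne'

/-- A measurable majorant of `‖f‖` with the same integral. -/
lemma exists_measurable_majorant {f : ℝ → ℂ} (hf : AEStronglyMeasurable f mI) :
    ∃ H : ℝ → ENNReal, Measurable H ∧ (∀ x, ‖f x‖ₑ ≤ H x) ∧ ∫⁻ x, H x ∂mI = normOne f := by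
  have hm : AEMeasurable (fun x => ‖f x‖ₑ) mI := hf.enorm
  have hnull : mI {x | ‖f x‖ₑ ≠ hm.mk _ x} = 0 := hm.ae_eq_mk
  set Z := toMeasurable mI {x | ‖f x‖ₑ ≠ hm.mk _ x} with hZ
  have hZ0 : mI Z = 0 := by rw [hZ, measure_toMeasurable, hnull]
  refine ⟨fun x => hm.mk _ x + Z.indicator (fun _ => ⊤) x,
    hm.measurable_mk.add (measurable_const.indicator (measurableSet_toMeasurable _ _)), ?_, ?_⟩
  · intro x
    by_cases hx : x ∈ Z
    · simp [indicator_of_mem hx]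
    · have : ‖f x‖ₑ = hm.mk _ x := by
        by_contra h; exact hx (subset_toMeasurable _ _ h)
      rw [this]; exact le_self_add
  · refine lintegral_congr_ae ?_
    have h1 : ∀ᵐ x ∂mI, x ∉ Z := measure_eq_zero_iff_ae_notMem.1 hZ0
    filter_upwards [h1, hm.ae_eq_mk] with x hx hx'
    rw [indicator_of_notMem hx, add_zero, hx']

variable {f : ℝ → ℂ}

lemma sum_branch_le_inner (ha : StrictMono a) (h0 : a 0 = 0) (h1 : a (Fin.last q) = 1)
    (hf : AEStronglyMeasurable f mI) {ρ R : ℝ} (hρ : 0 < ρ) (hρR : ρ ≤ R)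
    (hR : ∀ i : Fin q, 2 * R ≤ a i.succ - a i.castSucc) :
    ∑ i, ∫⁻ z, oscIn univ ((piece a i).indicator f) ρ z ≤
      (oscOne f ρ + normOne f) + ENNReal.ofReal (ρ / R) * (oscOne f R + normOne f) := by
  obtain ⟨H, hHm, hH, hHi⟩ := exists_measurable_majorant hf
  refine (Finset.sum_le_sum fun i _ => lintegral_branch_le_inner (piece_subset ha h0 h1 i)
    (fun x _ => hH x) hHm hρ hρR (hR i)).trans ?_
  rw [Finset.sum_add_distrib, ← Finset.mul_sum]
  have key : ∀ R, ∑ i, ∫⁻ z in piece a i, (oscIn (Icc 0 1) f R z + H z) ≤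
      oscOne f R + normOne f := fun R => by
    refine (sum_lintegral_piece_le ha h0 h1 _).trans ?_
    rw [lintegral_add_left (measurable_oscIn _ _ _), hHi]
    rfl
  exact add_le_add (key ρ) (mul_le_mul_right (key R) _)

lemma sum_branch_le_double (ha : StrictMono a) (h0 : a 0 = 0) (h1 : a (Fin.last q) = 1)
    (hf : AEStronglyMeasurable f mI) {ρ R : ℝ} (hρ : 0 < ρ) (hρR : ρ ≤ R)
    (hR : ∀ i : Fin q, 2 * R ≤ a i.succ - a i.castSucc) :
    ∑ i, ∫⁻ z, oscIn univ ((piece a i).indicator f) ρ z ≤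
      oscOne f ρ + (2 * ENNReal.ofReal (ρ / R)) * (oscOne f R + normOne f) := by
  obtain ⟨H, hHm, hH, hHi⟩ := exists_measurable_majorant hf
  refine (Finset.sum_le_sum fun i _ => lintegral_branch_le_double (piece_subset ha h0 h1 i)
    (fun x _ => hH x) hρ hρR (hR i)).trans ?_
  rw [Finset.sum_add_distrib, ← Finset.mul_sum]
  refine add_le_add (sum_lintegral_piece_le ha h0 h1 _) (mul_le_mul_right ?_ _)
  refine (sum_lintegral_piece_le ha h0 h1 _).trans ?_
  rw [lintegral_add_left (measurable_oscIn _ _ _), hHi]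
  rfl

lemma sum_branch_le_chain (ha : StrictMono a) (h0 : a 0 = 0) (h1 : a (Fin.last q) = 1)
    (hf : AEStronglyMeasurable f mI) {ρ ρ' : ℝ} (hρ : 0 < ρ) (hρ' : ρ < ρ') {N : ℕ} (hN : 0 < N)
    (hNρ : ∀ i : Fin q, 2 * ((2 * N + 2) * ρ) ≤ a i.succ - a i.castSucc) :
    ∑ i, ∫⁻ z, oscIn univ ((piece a i).indicator f) ρ z ≤
      oscOne f ρ' + (oscOne f ρ' + normOne f / N) := by
  obtain ⟨H, hHm, hH, hHi⟩ := exists_measurable_majorant hf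
  refine (Finset.sum_le_sum fun i _ => lintegral_branch_le_chain (piece_subset ha h0 h1 i)
    (fun x _ => hH x) hHm hρ hρ' hN (hNρ i)).trans ?_
  rw [Finset.sum_add_distrib, ← Finset.mul_sum, one_mul]
  refine add_le_add (sum_lintegral_piece_le ha h0 h1 _) ?_
  refine (sum_lintegral_piece_le ha h0 h1 _).trans ?_
  rw [lintegral_add_left (measurable_oscIn _ _ _)]
  simp only [div_eq_mul_inv]
  rw [lintegral_mul_const _ hHm, hHi]
  rfl

lemma combine_ofReal_le {x y c β K : ℝ} {V N : ENNReal} (hc : 0 ≤ c)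
    (hx : x ≤ c * β) (hy : y ≤ c * K) :
    ENNReal.ofReal x * V + ENNReal.ofReal y * N ≤
      ENNReal.ofReal c * (ENNReal.ofReal β * V + ENNReal.ofReal K * N) := by
  rw [mul_add, ← mul_assoc, ← mul_assoc, ← ENNReal.ofReal_mul hc, ← ENNReal.ofReal_mul hc]
  gcongr

lemma exists_sum_branch_le_one (ha : StrictMono a) (h0 : a 0 = 0) (h1 : a (Fin.last q) = 1)
    {s : ℝ} (hs1 : 1 < s) (hs : 1 / s ^ ((1 : ℝ) / 1) + 1 / s < 1) :
    ∃ β A₁ : ℝ, 0 < β ∧ β < 1 ∧ 0 < A₁ ∧ ∀ A, 0 < A → A ≤ A₁ → ∃ K, 0 < K ∧ ∀ f : ℝ → ℂ,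
      AEStronglyMeasurable f mI → ∀ r, 0 < r → r ≤ A →
        ∑ i, ∫⁻ z, oscIn univ ((piece a i).indicator f) (r / s) z ≤
          ENNReal.ofReal (r ^ ((1 : ℝ) / 1)) *
            (ENNReal.ofReal β * varFun A 1 f + ENNReal.ofReal K * normOne f) := by
  obtain ⟨γ, hγ, hgap⟩ := exists_gap ha
  have hs0 : 0 < s := by linarith
  rw [div_one, Real.rpow_one] at hs
  have hsinv : 0 < 1 / s := by positivity
  -- `β` lies strictly between `2 / s` and `1`, so `ρ' = β / 2 * r` exceeds `r / s` while two copies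
  -- of it cost exactly `β * r`. With `N < A / r + 1` the chains need a gap of at most `4 * (A + 2 *
  -- r) ≤ 12 * A`.
  refine ⟨(1 / s + 1 / s + 1) / 2, γ / 12, by positivity, by linarith, by positivity,
    fun A hA hAγ => ⟨1 / A, by positivity, fun f hf r hr hrA => ?_⟩⟩
  set β := (1 / s + 1 / s + 1) / 2 with hβ
  have hρ : 0 < r / s := by positivity
  have hρr : r / s < r := div_lt_self hr hs1
  have hρ' : r / s < β / 2 * r := by
    rw [div_eq_mul_one_div, mul_comm]; exact mul_lt_mul_of_pos_right (by linarith) hr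
  have hβ2 : β / 2 * r ≤ r := by
    have : β / 2 ≤ 1 := by linarith
    nlinarith
  have hAr : 0 < A / r := by positivity
  set N := ⌈A / r⌉₊ with hN
  have hN0 : 0 < N := Nat.ceil_pos.2 hAr
  have hN1 : A / r ≤ N := Nat.le_ceil _
  have hN2 : (N : ℝ) < A / r + 1 := Nat.ceil_lt_add_one hAr.le
  have hNρ : ∀ i : Fin q, 2 * ((2 * N + 2) * (r / s)) ≤ a i.succ - a i.castSucc := by
    intro i
    have e1 : (N : ℝ) * r ≤ A + r := by
      have := mul_lt_mul_of_pos_right hN2 hr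
      rw [add_mul, div_mul_cancel₀ _ hr.ne'] at this
      linarith
    have e2 : (2 * (N : ℝ) + 2) * (r / s) ≤ (2 * N + 2) * r :=
      mul_le_mul_of_nonneg_left hρr.le (by positivity)
    have := hgap i
    nlinarith
  refine (sum_branch_le_chain ha h0 h1 hf hρ hρ' hN0 hNρ).trans ?_
  have hosc := oscOne_le (p := 1) f (by positivity : 0 < β / 2 * r) (hβ2.trans hrA)
  rw [div_one, Real.rpow_one] at hosc
  have hnorm : normOne f / N ≤ ENNReal.ofReal (r / A) * normOne f := by
    rw [ENNReal.div_eq_inv_mul]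
    gcongr
    rw [← ENNReal.ofReal_natCast, ← ENNReal.ofReal_inv_of_pos (by exact_mod_cast hN0)]
    refine ENNReal.ofReal_le_ofReal ?_
    rw [← inv_div]
    exact inv_anti₀ hAr hN1
  have hb : 0 ≤ β / 2 * r := by positivity
  calc _ ≤ ENNReal.ofReal (β / 2 * r) * varFun A 1 f +
        (ENNReal.ofReal (β / 2 * r) * varFun A 1 f + ENNReal.ofReal (r / A) * normOne f) := by
        gcongr
    _ = ENNReal.ofReal (β / 2 * r + β / 2 * r) * varFun A 1 f +
        ENNReal.ofReal (r / A) * normOne f := by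
        rw [ENNReal.ofReal_add hb hb]; ring
    _ ≤ _ := by
        rw [div_one, Real.rpow_one]
        refine combine_ofReal_le hr.le (by linarith) (by rw [mul_one_div])

lemma exists_sum_branch_le_of_one_lt (ha : StrictMono a) (h0 : a 0 = 0) (h1 : a (Fin.last q) = 1)
    {p s : ℝ} (hp : 1 < p) (hs1 : 1 < s) (hs : 1 / s ^ (1 / p) + 1 / s < 1) :
    ∃ β A₁ : ℝ, 0 < β ∧ β < 1 ∧ 0 < A₁ ∧ ∀ A, 0 < A → A ≤ A₁ → ∃ K, 0 < K ∧ ∀ f : ℝ → ℂ,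
      AEStronglyMeasurable f mI → ∀ r, 0 < r → r ≤ A →
        ∑ i, ∫⁻ z, oscIn univ ((piece a i).indicator f) (r / s) z ≤
          ENNReal.ofReal (r ^ (1 / p)) *
            (ENNReal.ofReal β * varFun A p f + ENNReal.ofReal K * normOne f) := by
  obtain ⟨γ, hγ, hgap⟩ := exists_gap ha
  have hs0 : 0 < s := by linarith
  set ε := 1 / p with hε
  have hε0 : 0 < ε := by positivity
  have hε1 : ε < 1 := by rw [hε, div_lt_one (by linarith)]; exact hp
  have hsε : 0 < s ^ ε := Real.rpow_pos_of_pos hs0 _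
  -- The threshold for which `r < η * A` forces `(r / A) ^ (1 - ε) ≤ 1 / 2`.
  set η : ℝ := (1 / 2) ^ (1 / (1 - ε)) with hη
  have hη0 : 0 < η := by positivity
  have hη2 : η ^ (1 - ε) = 1 / 2 := by
    rw [hη, ← Real.rpow_mul (by norm_num), one_div_mul_cancel (by linarith), Real.rpow_one]
  refine ⟨1 / s ^ ε + 1 / s, γ / 2, by positivity, hs, by positivity,
    fun A hA hAγ => ⟨2 / (η * A) ^ ε, by positivity, fun f hf r hr hrA => ?_⟩⟩
  set β := 1 / s ^ ε + 1 / s with hβ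
  have hρ : 0 < r / s := by positivity
  have hρr : r / s < r := div_lt_self hr hs1
  have hR : ∀ i : Fin q, 2 * A ≤ a i.succ - a i.castSucc := fun i => by linarith [hgap i]
  have hrε : 0 < r ^ ε := Real.rpow_pos_of_pos hr _
  have hAε : 0 < A ^ ε := Real.rpow_pos_of_pos hA _
  have hρε : (r / s) ^ ε = r ^ ε * (1 / s ^ ε) := by
    rw [Real.div_rpow hr.le hs0.le]; ring
  have hsplit : r / A * A ^ ε = r ^ ε * (r / A) ^ (1 - ε) := by
    have e1 : r / A = (r / A) ^ ε * (r / A) ^ (1 - ε) := by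
      rw [← Real.rpow_add (by positivity)]; simp
    nth_rewrite 1 [e1]
    rw [Real.div_rpow hr.le hA.le]
    field_simp
  have hV1 := oscOne_le (p := p) f hρ (hρr.le.trans hrA)
  have hV2 := oscOne_le (p := p) f hA le_rfl
  have hrA1 : r / A ≤ 1 := (div_le_one hA).2 hrA
  have hrs : r / s / A = r / A * (1 / s) := by field_simp
  rcases le_or_gt (η * A) r with hcase | hcase
  -- Here `r ^ ε` is bounded below by `(η * A) ^ ε`, so the plain `normOne f` is absorbed into `K`.
  · refine (sum_branch_le_inner ha h0 h1 hf hρ (hρr.le.trans hrA) hR).trans ?_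
    have hq : 0 ≤ r / s / A := by positivity
    calc _ ≤ (ENNReal.ofReal ((r / s) ^ ε) * varFun A p f + normOne f) +
          ENNReal.ofReal (r / s / A) * (ENNReal.ofReal (A ^ ε) * varFun A p f + normOne f) := by
          gcongr
      _ = ENNReal.ofReal ((r / s) ^ ε + r / s / A * A ^ ε) * varFun A p f +
          ENNReal.ofReal (1 + r / s / A) * normOne f := by
          rw [ENNReal.ofReal_add (by positivity) (by positivity),
            ENNReal.ofReal_add (by norm_num) hq, ENNReal.ofReal_mul hq, ENNReal.ofReal_one]
          ring
      _ ≤ _ := by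
          refine combine_ofReal_le hrε.le ?_ ?_
          · rw [hρε, hrs, hβ, mul_add]
            have e2 : (r / A) ^ (1 - ε) ≤ 1 :=
              Real.rpow_le_one (by positivity) hrA1 (by linarith)
            have e3 : r / A * A ^ ε ≤ r ^ ε := by rw [hsplit]; nlinarith
            have e4 : r / A * (1 / s) * A ^ ε = (r / A * A ^ ε) * (1 / s) := by ring
            rw [e4]
            gcongr
          · have e1 : r / s / A ≤ 1 := by
              rw [hrs]
              have : 1 / s ≤ 1 := by rw [div_le_one hs0]; exact hs1.le
              have : 0 ≤ r / A := by positivity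
              have : 0 < 1 / s := by positivity
              nlinarith
            have e2 : (η * A) ^ ε ≤ r ^ ε := Real.rpow_le_rpow (by positivity) hcase hε0.le
            rw [← mul_div_assoc, le_div_iff₀ (by positivity)]
            have e3 : 0 < (η * A) ^ ε := by positivity
            nlinarith
  -- Below the threshold the factor two is cancelled by `(r / A) ^ (1 - ε) ≤ 1 / 2`.
  · refine (sum_branch_le_double ha h0 h1 hf hρ (hρr.le.trans hrA) hR).trans ?_
    have hq : 0 ≤ r / s / A := by positivity
    have hη1 : η ≤ 1 := Real.rpow_le_one (by norm_num) (by norm_num)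
      (by have : 0 < 1 - ε := by linarith
          positivity)
    have e2 : (r / A) ^ (1 - ε) ≤ 1 / 2 := by
      rw [← hη2]
      refine Real.rpow_le_rpow (by positivity) ?_ (by linarith)
      rw [div_le_iff₀ hA]; exact hcase.le
    have e3 : 2 * (r / A * A ^ ε) ≤ r ^ ε := by rw [hsplit]; nlinarith
    calc _ ≤ ENNReal.ofReal ((r / s) ^ ε) * varFun A p f +
          2 * ENNReal.ofReal (r / s / A) *
            (ENNReal.ofReal (A ^ ε) * varFun A p f + normOne f) := by
          gcongr
      _ = ENNReal.ofReal ((r / s) ^ ε + 2 * (r / s / A * A ^ ε)) * varFun A p f +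
          ENNReal.ofReal (2 * (r / s / A)) * normOne f := by
          rw [ENNReal.ofReal_add (by positivity) (by positivity),
            ENNReal.ofReal_mul (by norm_num), ENNReal.ofReal_mul (p := 2) (by norm_num),
            ENNReal.ofReal_mul hq, ENNReal.ofReal_ofNat]
          ring
      _ ≤ _ := by
          refine combine_ofReal_le hrε.le ?_ ?_
          · rw [hρε, hrs, hβ, mul_add]
            have e4 : 2 * (r / A * (1 / s) * A ^ ε) = (2 * (r / A * A ^ ε)) * (1 / s) := by ring
            rw [e4]
            gcongr
          · have e5 : r / s / A ≤ r / A := by gcongr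
            have e6 : (η * A) ^ ε ≤ A ^ ε :=
              Real.rpow_le_rpow (by positivity) (by nlinarith) hε0.le
            rw [← mul_div_assoc (r ^ ε), le_div_iff₀ (by positivity)]
            have e7 : 0 < (η * A) ^ ε := by positivity
            have e8 : r / s / A * (η * A) ^ ε ≤ r / A * A ^ ε :=
              mul_le_mul e5 e6 e7.le (by positivity)
            nlinarith

end Partition


/-! ### The Frobenius-Perron operator and the Lasota-Yorke inequality -/

section Operator

variable {q : ℕ} {a : Fin (q + 1) → ℝ} {τ : ℝ → ℝ} {p σ M : ℝ}

/-- The contribution of the `i`-th branch to the Frobenius-Perron operator. -/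
def branchTerm (a : Fin (q + 1) → ℝ) (τ : ℝ → ℝ) (f : ℝ → ℂ) (i : Fin q) : ℝ → ℂ :=
  (τ '' piece a i).indicator
    (fun x => f (Function.invFunOn τ (piece a i) x) /
      (|deriv τ (Function.invFunOn τ (piece a i) x)| : ℝ))

lemma frobeniusPerron_eq_sum (f : ℝ → ℂ) :
    frobeniusPerron a τ f = fun x => ∑ i, branchTerm a τ f i x := rfl

/-- The properties of a branch used in the estimates. -/
structure ExpandingBranch (a : Fin (q + 1) → ℝ) (τ : ℝ → ℝ) (σ : ℝ) (i : Fin q) : Prop where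
  one_lt : 1 < σ
  lt : a i.castSucc < a i.succ
  subset : piece a i ⊆ Icc 0 1
  mapsTo : MapsTo τ (Icc 0 1) (Icc 0 1)
  sign : (∀ x ∈ piece a i, σ ≤ deriv τ x) ∨ (∀ x ∈ piece a i, σ ≤ -deriv τ x)

/-- Monotonicity fixes the sign of the derivative on the whole piece, which turns the bound on its
absolute value into a one-sided one. -/
lemma IsPiecewiseExpanding.expandingBranch {ε : ℝ} {s : Fin q → ℝ}
    (hτ : IsPiecewiseExpanding ε a s τ) (hσ1 : 1 < σ) (hσ : ∀ i, σ ≤ s i) (i : Fin q) :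
    ExpandingBranch a τ σ i := by
  refine ⟨hσ1, hτ.strictMono (by rw [Fin.lt_def]; simp),
    piece_subset hτ.strictMono hτ.first hτ.last i, hτ.mapsTo, ?_⟩
  have hopen : ∀ x ∈ piece a i, derivWithin τ (piece a i) x = deriv τ x := fun x hx =>
    derivWithin_of_isOpen isOpen_Ioo hx
  have hexp := hτ.expanding i
  rcases hτ.monotonic i with h | h
  · left
    intro x hx
    have h0 : 0 ≤ deriv τ x := by rw [← hopen x hx]; exact h.derivWithin_nonneg
    have := hexp x hx
    rw [abs_of_nonneg h0] at this
    exact (hσ i).trans this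
  · right
    intro x hx
    have h0 : deriv τ x ≤ 0 := by rw [← hopen x hx]; exact h.derivWithin_nonpos
    have := hexp x hx
    rw [abs_of_nonpos h0] at this
    exact (hσ i).trans this

namespace ExpandingBranch

variable {i : Fin q} (h : ExpandingBranch a τ σ i)
include h

lemma differentiableAt {w : ℝ} (hw : w ∈ piece a i) : DifferentiableAt ℝ τ w := by
  have := h.one_lt
  refine differentiableAt_of_deriv_ne_zero ?_
  rcases h.sign with H | H
  · have := H w hw; intro h0; linarith
  · have := H w hw; intro h0; linarith

lemma strict : StrictMonoOn τ (piece a i) ∨ StrictAntiOn τ (piece a i) := by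
  have h1 := h.one_lt
  rcases h.sign with H | H
  · left
    intro x hx y hy hxy
    have := mul_sub_le_sub_of_le_deriv (by linarith) H hx hy hxy.le
    nlinarith
  · right
    intro x hx y hy hxy
    have := mul_sub_le_sub_of_le_deriv (σ := σ) (τ := fun x => -τ x) (by linarith)
      (fun w hw => by rw [deriv.fun_neg]; exact H w hw) hx hy hxy.le
    nlinarith

lemma injOn : InjOn τ (piece a i) := h.strict.elim (fun H => H.injOn) (fun H => H.injOn)

lemma invFunOn_apply {w : ℝ} (hw : w ∈ piece a i) : Function.invFunOn τ (piece a i) (τ w) = w :=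
  h.injOn.leftInvOn_invFunOn hw

lemma branchTerm_apply (f : ℝ → ℂ) {w : ℝ} (hw : w ∈ piece a i) :
    branchTerm a τ f i (τ w) = f w / (|deriv τ w| : ℝ) := by
  rw [branchTerm, indicator_of_mem (mem_image_of_mem _ hw), h.invFunOn_apply hw]

omit h in
lemma branchTerm_of_notMem (f : ℝ → ℂ) {x : ℝ} (hx : x ∉ τ '' piece a i) :
    branchTerm a τ f i x = 0 := indicator_of_notMem hx _

lemma image_subset : τ '' piece a i ⊆ Icc 0 1 :=
  (image_mono h.subset).trans h.mapsTo.image_subset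

lemma lintegral_oscIn_branchTerm_le (f : ℝ → ℂ) {ε r : ℝ} (hε : 0 ≤ ε) (hM0 : 0 ≤ M)
    (hM : ∀ x ∈ piece a i, ∀ y ∈ piece a i, |deriv τ x - deriv τ y| ≤ M * |x - y| ^ ε)
    (hr : 0 < r) :
    ∫⁻ x, oscIn univ (branchTerm a τ f i) r x ≤
      (1 + ENNReal.ofReal (2 * (M * r ^ ε))) *
        (∫⁻ z, oscIn univ ((piece a i).indicator f) (r / σ) z) +
      ENNReal.ofReal (2 * (M * r ^ ε)) * ∫⁻ z in piece a i, ‖f z‖ₑ := by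
  have h1 := h.one_lt
  rcases h.sign with H | H
  · refine lintegral_oscIn_transfer (τ := τ) h.lt h1.le hε hM0 hr H hM
      (bddBelow_Icc.mono h.image_subset) (bddAbove_Icc.mono h.image_subset) (fun w hw => ?_)
      (fun x hx => branchTerm_of_notMem f hx)
    rw [h.branchTerm_apply f hw, abs_of_pos (by linarith [H w hw])]
  -- A decreasing branch becomes increasing after reflecting the target; reflection does not change
  -- the integral over the line.
  · rw [← lintegral_oscIn_comp_neg]
    have himg : ∀ y ∈ (fun x => -τ x) '' piece a i, y ∈ Icc (-1 : ℝ) 0 := by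
      rintro y ⟨w, hw, rfl⟩
      have := h.image_subset (mem_image_of_mem τ hw)
      exact ⟨neg_le_neg this.2, neg_nonpos.2 this.1⟩
    refine lintegral_oscIn_transfer (τ := fun x => -τ x) h.lt h1.le hε hM0 hr
      (fun w hw => by rw [deriv.fun_neg]; exact H w hw)
      (fun x hx y hy => ?_) (bddBelow_Icc.mono himg) (bddAbove_Icc.mono himg) (fun w hw => ?_)
      (fun x hx => branchTerm_of_notMem f fun ⟨w, hw, e⟩ => hx ⟨w, hw, by simp [e]⟩)
    · rw [deriv.fun_neg, deriv.fun_neg, neg_sub_neg, abs_sub_comm]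
      exact hM x hx y hy
    · rw [neg_neg, h.branchTerm_apply f hw, abs_of_neg (by linarith [H w hw]), deriv.fun_neg]

lemma measurableSet_image : MeasurableSet (τ '' piece a i) :=
  measurableSet_Ioo.image_of_continuousOn_injOn
    (fun _ hw => (h.differentiableAt hw).continuousAt.continuousWithinAt) h.injOn

lemma lintegral_branchTerm (f : ℝ → ℂ) :
    ∫⁻ x, ‖branchTerm a τ f i x‖ₑ = ∫⁻ z in piece a i, ‖f z‖ₑ := by
  have h1 := h.one_lt
  have hmp : MeasurableSet (piece a i) := measurableSet_Ioo
  have hsupp : ∫⁻ x, ‖branchTerm a τ f i x‖ₑ =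
      ∫⁻ x in τ '' piece a i, ‖branchTerm a τ f i x‖ₑ := by
    refine (setLIntegral_eq_of_support_subset fun x hx => ?_).symm
    by_contra hn
    exact hx (by simp [branchTerm_of_notMem f hn])
  rw [hsupp, lintegral_image_eq_lintegral_abs_deriv_mul hmp
    (fun w hw => (h.differentiableAt hw).hasDerivAt.hasDerivWithinAt) h.injOn]
  refine setLIntegral_congr_fun hmp fun w hw => ?_
  have hpos : 0 < |deriv τ w| := by
    rcases h.sign with H | H
    · exact abs_pos.2 (by linarith [H w hw])
    · exact abs_pos.2 (by have := H w hw; intro h0; linarith)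
  rw [h.branchTerm_apply f hw, div_eq_inv_mul, ← Complex.ofReal_inv,
    enorm_real_mul _ (inv_pos.2 hpos).le, ← mul_assoc, ← ENNReal.ofReal_mul hpos.le,
    mul_inv_cancel₀ hpos.ne', ENNReal.ofReal_one, one_mul]

/-- A differentiable map sends null sets to null sets, so the branch term depends only on the class
of `f`. This lets the variation be minimised over versions. -/
lemma branchTerm_congr_ae {f g : ℝ → ℂ} (hfg : f =ᵐ[mI] g) :
    branchTerm a τ f i =ᵐ[volume] branchTerm a τ g i := by
  have h0 : volume (piece a i ∩ {x | f x ≠ g x}) = 0 := by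
    have h2 : mI {x | f x ≠ g x} = 0 := hfg
    refine le_antisymm ?_ zero_le
    calc _ ≤ volume ({x | f x ≠ g x} ∩ Icc 0 1) := by
          rw [inter_comm]; exact measure_mono (inter_subset_inter_right _ h.subset)
      _ ≤ mI {x | f x ≠ g x} := Measure.le_restrict_apply _ _
      _ = 0 := h2
  have h1 : volume (τ '' (piece a i ∩ {x | f x ≠ g x})) = 0 :=
    addHaar_image_eq_zero_of_differentiableOn_of_addHaar_eq_zero volume
      (fun w hw => (h.differentiableAt hw.1).differentiableWithinAt) h0
  refine measure_mono_null (fun x hx => ?_) h1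
  by_cases hxJ : x ∈ τ '' piece a i
  · obtain ⟨w, hw, rfl⟩ := hxJ
    refine ⟨w, ⟨hw, fun e => hx ?_⟩, rfl⟩
    show branchTerm a τ f i (τ w) = branchTerm a τ g i (τ w)
    rw [h.branchTerm_apply f hw, h.branchTerm_apply g hw, e]
  · exact absurd (by
      show branchTerm a τ f i x = branchTerm a τ g i x
      rw [branchTerm_of_notMem f hxJ, branchTerm_of_notMem g hxJ]) hx

/-- The inverse branch is monotone on the image, and a measurable version of `f` may be used because
null changes of `f` are harmless. -/
lemma aemeasurable_branchTerm {f : ℝ → ℂ} (hf : AEStronglyMeasurable f mI) :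
    AEMeasurable (branchTerm a τ f i) volume := by
  have hm : Measurable (hf.mk f) := hf.stronglyMeasurable_mk.measurable
  refine AEMeasurable.congr ?_ (h.branchTerm_congr_ae hf.ae_eq_mk).symm
  rw [branchTerm, aemeasurable_indicator_iff h.measurableSet_image]
  have hinv : AEMeasurable (Function.invFunOn τ (piece a i)) (volume.restrict (τ '' piece a i)) := by
    rcases h.strict with H | H
    · refine aemeasurable_restrict_of_monotoneOn h.measurableSet_image ?_
      rintro _ ⟨x, hx, rfl⟩ _ ⟨y, hy, rfl⟩ hxy
      rw [h.invFunOn_apply hx, h.invFunOn_apply hy]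
      exact (H.le_iff_le hx hy).1 hxy
    · refine aemeasurable_restrict_of_antitoneOn h.measurableSet_image ?_
      rintro _ ⟨x, hx, rfl⟩ _ ⟨y, hy, rfl⟩ hxy
      rw [h.invFunOn_apply hx, h.invFunOn_apply hy]
      exact (H.le_iff_ge hx hy).1 hxy
  have hden : Measurable fun w => ((|deriv τ w| : ℝ) : ℂ) :=
    Complex.measurable_ofReal.comp (measurable_deriv τ).abs
  exact (hm.comp_aemeasurable hinv).div (hden.comp_aemeasurable hinv)

end ExpandingBranch

lemma frobeniusPerron_congr_ae (hB : ∀ i, ExpandingBranch a τ σ i) {f g : ℝ → ℂ}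
    (hfg : f =ᵐ[mI] g) : frobeniusPerron a τ f =ᵐ[mI] frobeniusPerron a τ g := by
  have : ∀ᵐ x ∂mI, ∀ i, branchTerm a τ f i x = branchTerm a τ g i x :=
    ae_all_iff.2 fun i => ae_restrict_of_ae ((hB i).branchTerm_congr_ae hfg)
  filter_upwards [this] with x hx
  rw [frobeniusPerron_eq_sum, frobeniusPerron_eq_sum]
  exact Finset.sum_congr rfl fun i _ => hx i

lemma aestronglyMeasurable_frobeniusPerron (hB : ∀ i, ExpandingBranch a τ σ i) {f : ℝ → ℂ}
    (hf : AEStronglyMeasurable f mI) : AEStronglyMeasurable (frobeniusPerron a τ f) mI := by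
  rw [frobeniusPerron_eq_sum]
  exact (Finset.aemeasurable_fun_sum _ fun i _ =>
    ((hB i).aemeasurable_branchTerm hf).restrict).aestronglyMeasurable

lemma normOne_frobeniusPerron_le (ha : StrictMono a) (h0 : a 0 = 0) (h1 : a (Fin.last q) = 1)
    (hB : ∀ i, ExpandingBranch a τ σ i) {f : ℝ → ℂ} (hf : AEStronglyMeasurable f mI) :
    normOne (frobeniusPerron a τ f) ≤ normOne f := by
  calc normOne (frobeniusPerron a τ f) ≤ ∫⁻ x, ∑ i, ‖branchTerm a τ f i x‖ₑ ∂mI :=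
        lintegral_mono fun x => enorm_sum_le _ _
    _ ≤ ∫⁻ x, ∑ i, ‖branchTerm a τ f i x‖ₑ := setLIntegral_le_lintegral _ _
    _ = ∑ i, ∫⁻ x, ‖branchTerm a τ f i x‖ₑ :=
        lintegral_finsetSum' _ fun i _ => ((hB i).aemeasurable_branchTerm hf).enorm
    _ = ∑ i, ∫⁻ z in piece a i, ‖f z‖ₑ :=
        Finset.sum_congr rfl fun i _ => (hB i).lintegral_branchTerm f
    _ ≤ normOne f := sum_lintegral_piece_le ha h0 h1 _

lemma oscOne_frobeniusPerron_le (ha : StrictMono a) (h0 : a 0 = 0) (h1 : a (Fin.last q) = 1)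
    (hB : ∀ i, ExpandingBranch a τ σ i) {ε r : ℝ} (hε : 0 ≤ ε) (hM0 : 0 ≤ M)
    (hM : ∀ i, ∀ x ∈ piece a i, ∀ y ∈ piece a i, |deriv τ x - deriv τ y| ≤ M * |x - y| ^ ε)
    (hr : 0 < r) (f : ℝ → ℂ) :
    oscOne (frobeniusPerron a τ f) r ≤
      (1 + ENNReal.ofReal (2 * (M * r ^ ε))) *
        (∑ i, ∫⁻ z, oscIn univ ((piece a i).indicator f) (r / σ) z) +
      ENNReal.ofReal (2 * (M * r ^ ε)) * normOne f := by
  calc oscOne (frobeniusPerron a τ f) r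
      ≤ ∫⁻ x, ∑ i, oscIn univ (branchTerm a τ f i) r x ∂mI :=
        lintegral_mono fun x => oscIn_sum_le _ _ (branchTerm a τ f) r x
    _ ≤ ∫⁻ x, ∑ i, oscIn univ (branchTerm a τ f i) r x := setLIntegral_le_lintegral _ _
    _ = ∑ i, ∫⁻ x, oscIn univ (branchTerm a τ f i) r x :=
        lintegral_finsetSum _ fun i _ => measurable_oscIn _ _ _
    _ ≤ _ := Finset.sum_le_sum fun i _ =>
        (hB i).lintegral_oscIn_branchTerm_le f hε hM0 (hM i) hr
    _ ≤ _ := by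
        rw [Finset.sum_add_distrib, ← Finset.mul_sum, ← Finset.mul_sum]
        gcongr
        exact sum_lintegral_piece_le ha h0 h1 _

lemma varFun_le {A : ℝ} {f : ℝ → ℂ} {c : ENNReal}
    (h : ∀ r, 0 < r → r ≤ A → oscOne f r ≤ ENNReal.ofReal (r ^ (1 / p)) * c) :
    varFun A p f ≤ c := by
  refine iSup₂_le fun r hr => ENNReal.div_le_of_le_mul ?_
  rw [mul_comm]
  exact h r hr.1 hr.2

lemma var_le_varFun {A : ℝ} {f g : ℝ → ℂ} (h : g =ᵐ[mI] f) : var A p f ≤ varFun A p g :=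
  iInf₂_le (f := fun g (_ : g =ᵐ[mI] f) => varFun A p g) g h

lemma normOne_congr {f g : ℝ → ℂ} (h : f =ᵐ[mI] g) : normOne f = normOne g :=
  lintegral_congr_ae (h.mono fun x hx => by simp only [hx])

lemma exists_sum_branch_le (ha : StrictMono a) (h0 : a 0 = 0) (h1 : a (Fin.last q) = 1)
    {s : ℝ} (hp : 1 ≤ p) (hs1 : 1 < s) (hs : 1 / s ^ (1 / p) + 1 / s < 1) :
    ∃ β A₁ : ℝ, 0 < β ∧ β < 1 ∧ 0 < A₁ ∧ ∀ A, 0 < A → A ≤ A₁ → ∃ K, 0 < K ∧ ∀ f : ℝ → ℂ,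
      AEStronglyMeasurable f mI → ∀ r, 0 < r → r ≤ A →
        ∑ i, ∫⁻ z, oscIn univ ((piece a i).indicator f) (r / s) z ≤
          ENNReal.ofReal (r ^ (1 / p)) *
            (ENNReal.ofReal β * varFun A p f + ENNReal.ofReal K * normOne f) := by
  rcases hp.eq_or_lt with rfl | hp
  · exact exists_sum_branch_le_one ha h0 h1 hs1 hs
  · exact exists_sum_branch_le_of_one_lt ha h0 h1 hp hs1 hs

/-- The Lasota-Yorke inequality for the variation. -/
lemma exists_var_frobeniusPerron_le (ha : StrictMono a) (h0 : a 0 = 0) (h1 : a (Fin.last q) = 1)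
    (hB : ∀ i, ExpandingBranch a τ σ i) (hp : 1 ≤ p) (hM0 : 0 ≤ M)
    (hM : ∀ i, ∀ x ∈ piece a i, ∀ y ∈ piece a i, |deriv τ x - deriv τ y| ≤ M * |x - y| ^ (1 / p))
    (hσ1 : 1 < σ) (hσ : 1 / σ ^ (1 / p) + 1 / σ < 1) :
    ∃ α A₀ : ℝ, 0 < α ∧ α < 1 ∧ 0 < A₀ ∧ ∀ A, 0 < A → A ≤ A₀ → ∃ K, 0 < K ∧ ∀ f : ℝ → ℂ,
      AEStronglyMeasurable f mI → var A p (frobeniusPerron a τ f) ≤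
        ENNReal.ofReal α * var A p f + ENNReal.ofReal K * normOne f := by
  obtain ⟨β, A₁, hβ0, hβ1, hA₁, hT⟩ := exists_sum_branch_le ha h0 h1 hp hσ1 hσ
  have hε : 0 ≤ 1 / p := by positivity
  set δ := ((1 + β) / 2) / β - 1 with hδ
  have hδ0 : 0 < δ := by rw [hδ, sub_pos, one_lt_div hβ0]; linarith
  have hδβ : (1 + δ) * β = (1 + β) / 2 := by rw [hδ]; field_simp; ring
  -- The distortion may use up half of the gap between `β` and `1`: this `A₀` makes `2 * M * r ^ (1
  -- / p) ≤ δ`, and `(1 + δ) * β` is the midpoint. The `+ 1` covers `M = 0`.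
  refine ⟨(1 + β) / 2, min A₁ ((δ / (2 * M + 1)) ^ p), by positivity, by linarith,
    lt_min hA₁ (by positivity), fun A hA hAA => ?_⟩
  obtain ⟨K, hK, hT⟩ := hT A hA (hAA.trans (min_le_left _ _))
  have hMA : ∀ r, 0 < r → r ≤ A → 2 * (M * r ^ (1 / p)) ≤ δ := by
    intro r hr hrA
    have e1 : r ^ (1 / p) ≤ δ / (2 * M + 1) := by
      calc r ^ (1 / p) ≤ ((δ / (2 * M + 1)) ^ p) ^ (1 / p) :=
            Real.rpow_le_rpow hr.le (hrA.trans (hAA.trans (min_le_right _ _))) hε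
        _ = δ / (2 * M + 1) := by
            rw [← Real.rpow_mul (by positivity), mul_one_div_cancel (by linarith), Real.rpow_one]
    rw [le_div_iff₀ (by positivity)] at e1
    have e2 : 0 ≤ r ^ (1 / p) := Real.rpow_nonneg hr.le _
    nlinarith
  refine ⟨(1 + δ) * K + 2 * M, by positivity, fun f hf => ?_⟩
  have hvar : ∀ g : ℝ → ℂ, g =ᵐ[mI] f → varFun A p (frobeniusPerron a τ g) ≤
      ENNReal.ofReal ((1 + β) / 2) * varFun A p g +
        ENNReal.ofReal ((1 + δ) * K + 2 * M) * normOne f := by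
    intro g hg
    have hgm : AEStronglyMeasurable g mI := hf.congr hg.symm
    rw [← normOne_congr hg]
    refine varFun_le fun r hr hrA => ?_
    have hrε : 0 ≤ r ^ (1 / p) := Real.rpow_nonneg hr.le _
    refine (oscOne_frobeniusPerron_le ha h0 h1 hB hε hM0 hM hr g).trans ?_
    have e1 : (1 : ENNReal) + ENNReal.ofReal (2 * (M * r ^ (1 / p))) ≤ ENNReal.ofReal (1 + δ) := by
      rw [← ENNReal.ofReal_one, ← ENNReal.ofReal_add one_pos.le (by positivity)]
      exact ENNReal.ofReal_le_ofReal (by linarith [hMA r hr hrA])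
    have e2 : ENNReal.ofReal (2 * (M * r ^ (1 / p))) =
        ENNReal.ofReal (r ^ (1 / p)) * ENNReal.ofReal (2 * M) := by
      rw [← ENNReal.ofReal_mul hrε]; congr 1; ring
    calc _ ≤ ENNReal.ofReal (1 + δ) * (ENNReal.ofReal (r ^ (1 / p)) *
          (ENNReal.ofReal β * varFun A p g + ENNReal.ofReal K * normOne g)) +
          ENNReal.ofReal (r ^ (1 / p)) * ENNReal.ofReal (2 * M) * normOne g :=
          add_le_add (mul_le_mul' e1 (hT g hgm r hr hrA)) (by rw [e2])
      _ = _ := by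
          rw [← hδβ, ENNReal.ofReal_add (p := (1 + δ) * K) (by positivity) (by positivity),
            ENNReal.ofReal_mul (p := 1 + δ) (by positivity),
            ENNReal.ofReal_mul (p := 1 + δ) (by positivity)]
          ring
  have hα0 : ENNReal.ofReal ((1 + β) / 2) ≠ 0 := (ENNReal.ofReal_pos.2 (by positivity)).ne'
  -- Each version `g` of `f` yields a version of the image of `f`, so the bounds for individual
  -- versions pass to the infimum; a nonzero finite factor commutes with it.
  have hv : ENNReal.ofReal ((1 + β) / 2) * var A p f =
      ⨅ (g : ℝ → ℂ) (_ : g =ᵐ[mI] f), ENNReal.ofReal ((1 + β) / 2) * varFun A p g := by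
    simp only [var, ENNReal.mul_iInf_of_ne hα0 ENNReal.ofReal_ne_top]
  rw [hv]
  simp only [ENNReal.iInf_add]
  refine le_iInf₂ fun g hg => ?_
  exact (var_le_varFun (frobeniusPerron_congr_ae hB hg)).trans (hvar g hg)

lemma exists_holder_bound {ε : ℝ} {s : Fin q → ℝ} (hτ : IsPiecewiseExpanding ε a s τ) :
    ∃ M : ℝ, 0 ≤ M ∧ ∀ i, ∀ x ∈ piece a i, ∀ y ∈ piece a i,
      |deriv τ x - deriv τ y| ≤ M * |x - y| ^ ε := by
  choose M hM using hτ.holder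
  refine ⟨∑ i, |M i|, Finset.sum_nonneg fun i _ => abs_nonneg _, fun i x hx y hy => ?_⟩
  refine (hM i x hx y hy).trans (mul_le_mul_of_nonneg_right ?_ (Real.rpow_nonneg (abs_nonneg _) _))
  exact (le_abs_self _).trans
    (Finset.single_le_sum (f := fun i => |M i|) (fun i _ => abs_nonneg _) (Finset.mem_univ i))

lemma normBV_eq_zero_of_normOne_eq_zero {A : ℝ} {f : ℝ → ℂ} (hf : AEStronglyMeasurable f mI)
    (h : normOne f = 0) : normBV A p f = 0 := by
  have h0 : (fun _ => (0 : ℂ)) =ᵐ[mI] f := by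
    have := (lintegral_eq_zero_iff' hf.enorm).1 h
    filter_upwards [this] with x hx
    exact (enorm_eq_zero.1 hx).symm
  have hv : var A p f ≤ 0 := by
    refine (var_le_varFun h0).trans (varFun_le fun r _ _ => ?_)
    have : oscOne (fun _ => (0 : ℂ)) r ≤ 0 := by
      calc _ ≤ ∫⁻ _, 0 ∂mI := lintegral_mono fun x => by
            rw [osc_eq_oscIn]; exact oscIn_le fun _ _ _ _ => by simp
        _ = 0 := lintegral_zero
    exact this.trans zero_le
  rw [normBV, h, add_zero]
  exact le_antisymm hv zero_le

/-- Consequences of a Lasota-Yorke inequality for the iterates. -/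
lemma normBV_iterate_le {A α K : ℝ} (hα0 : 0 < α) (hα1 : α < 1) (hK : 0 < K)
    (ha : StrictMono a) (h0 : a 0 = 0) (h1 : a (Fin.last q) = 1)
    (hB : ∀ i, ExpandingBranch a τ σ i)
    (hLY : ∀ f : ℝ → ℂ, MemBV A p f → normBV A p (frobeniusPerron a τ f) ≤
      ENNReal.ofReal α * normBV A p f + ENNReal.ofReal K * normOne f)
    {f : ℝ → ℂ} (hf : MemBV A p f) (n : ℕ) :
    MemBV A p ((frobeniusPerron a τ)^[n] f) ∧
      normOne ((frobeniusPerron a τ)^[n] f) ≤ normOne f ∧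
      normBV A p ((frobeniusPerron a τ)^[n] f) ≤
        ENNReal.ofReal (α ^ n) * normBV A p f + ENNReal.ofReal (K / (1 - α)) * normOne f := by
  have hα : 0 < 1 - α := by linarith
  induction n with
  | zero =>
    refine ⟨hf, le_rfl, ?_⟩
    simp
  | succ n ih =>
    obtain ⟨hm, hn, hb⟩ := ih
    rw [Function.iterate_succ_apply']
    set g := (frobeniusPerron a τ)^[n] f
    have hn' := normOne_frobeniusPerron_le ha h0 h1 hB hm.1.aestronglyMeasurable
    have hgfin : normOne g < ⊤ := hm.1.2
    have hbv := hLY g hm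
    refine ⟨⟨⟨aestronglyMeasurable_frobeniusPerron hB hm.1.aestronglyMeasurable,
      hn'.trans_lt hgfin⟩, ?_⟩, hn'.trans hn, hbv.trans ?_⟩
    · refine lt_of_le_of_lt (le_self_add.trans hbv) ?_
      refine ENNReal.add_lt_top.2 ⟨ENNReal.mul_lt_top ENNReal.ofReal_lt_top
        (ENNReal.add_lt_top.2 ⟨hm.2, hgfin⟩), ENNReal.mul_lt_top ENNReal.ofReal_lt_top hgfin⟩
    · calc _ ≤ ENNReal.ofReal α * (ENNReal.ofReal (α ^ n) * normBV A p f +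
            ENNReal.ofReal (K / (1 - α)) * normOne f) + ENNReal.ofReal K * normOne f := by gcongr
        _ = ENNReal.ofReal (α * α ^ n) * normBV A p f +
            ENNReal.ofReal (α * (K / (1 - α)) + K) * normOne f := by
            rw [ENNReal.ofReal_add (by positivity) hK.le, ENNReal.ofReal_mul hα0.le,
              ENNReal.ofReal_mul hα0.le]
            ring
        -- `K / (1 - α)` is the fixed point of `x ↦ α * x + K`.
        _ = _ := by
            congr 3
            · rw [pow_succ']
            · field_simp; ring

end Operator

end GenBV

end

theorem theorem3p2p3 (p : ℝ) (hp : 1 ≤ p) (q : ℕ) (a : Fin (q + 1) → ℝ) (s : Fin q → ℝ)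
    (τ : ℝ → ℝ) (hτ : GenBV.IsPiecewiseExpanding (1 / p) a s τ)
    (hs : 1 / (⨅ i, s i) ^ (1 / p) + 1 / (⨅ i, s i) < 1) :
    ∃ A₀ : ℝ, 0 < A₀ ∧ ∀ A : ℝ, 0 < A → A ≤ A₀ →
      ∃ α K : ℝ, 0 < α ∧ α < 1 ∧ 0 < K ∧
        -- `α` and `K` are constants of a Lasota-Yorke inequality
        (∀ f : ℝ → ℂ, GenBV.MemBV A p f →
          GenBV.normBV A p (GenBV.frobeniusPerron a τ f) ≤
            ENNReal.ofReal α * GenBV.normBV A p f + ENNReal.ofReal K * GenBV.normOne f) ∧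
        -- the iterates are uniformly bounded on `BV_{1,1/p}`
        (∀ f : ℝ → ℂ, GenBV.MemBV A p f → ∀ n : ℕ,
          GenBV.MemBV A p ((GenBV.frobeniusPerron a τ)^[n] f) ∧
          GenBV.normBV A p ((GenBV.frobeniusPerron a τ)^[n] f) ≤
            ENNReal.ofReal (1 + K / (1 - α)) * GenBV.normBV A p f) ∧
        -- for large `n` they are bounded by the `L¹`-norm
        (∀ f : ℝ → ℂ, GenBV.MemBV A p f → ∀ᶠ n : ℕ in Filter.atTop,
          GenBV.normBV A p ((GenBV.frobeniusPerron a τ)^[n] f) ≤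
            ENNReal.ofReal (1 + K / (1 - α)) * GenBV.normOne f) := by
  have hne : Nonempty (Fin q) := by
    rcases Nat.eq_zero_or_pos q with rfl | h
    · have h1 := hτ.first
      have h2 := hτ.last
      exact absurd (h1.symm.trans h2) zero_ne_one
    · exact ⟨⟨0, h⟩⟩
  have hσ : ∀ i, (⨅ i, s i) ≤ s i := fun i => ciInf_le (Set.finite_range s).bddBelow i
  have hσ1 : 1 < ⨅ i, s i := by
    obtain ⟨i, hi⟩ := exists_eq_ciInf_of_finite (f := s)
    rw [← hi]; exact hτ.one_lt i
  obtain ⟨M, hM0, hM⟩ := GenBV.exists_holder_bound hτ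
  have hB := hτ.expandingBranch hσ1 hσ
  have ha := hτ.strictMono
  have h0 := hτ.first
  have h1 := hτ.last
  obtain ⟨α, A₀, hα0, hα1, hA₀, hLY⟩ :=
    GenBV.exists_var_frobeniusPerron_le ha h0 h1 hB hp hM0 hM hσ1 hs
  refine ⟨A₀, hA₀, fun A hA hAA => ?_⟩
  obtain ⟨K, hK, hLY⟩ := hLY A hA hAA
  have hα : 0 < 1 - α := by linarith
  have hLY' : ∀ f : ℝ → ℂ, GenBV.MemBV A p f →
      GenBV.normBV A p (GenBV.frobeniusPerron a τ f) ≤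
        ENNReal.ofReal α * GenBV.normBV A p f + ENNReal.ofReal (K + 1) * GenBV.normOne f := by
    intro f hf
    -- The L¹ part of the norm does not contract; it accounts for the extra `1` in the constant `K +
    -- 1`.
    calc _ ≤ (ENNReal.ofReal α * GenBV.var A p f + ENNReal.ofReal K * GenBV.normOne f) +
          GenBV.normOne f := add_le_add (hLY f hf.1.aestronglyMeasurable)
            (GenBV.normOne_frobeniusPerron_le ha h0 h1 hB hf.1.aestronglyMeasurable)
      _ = ENNReal.ofReal α * GenBV.var A p f + ENNReal.ofReal (K + 1) * GenBV.normOne f := by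
          rw [ENNReal.ofReal_add hK.le one_pos.le, ENNReal.ofReal_one]; ring
      _ ≤ _ := by
          gcongr
          exact le_self_add
  have hK1 : 0 < K + 1 := by linarith
  have hit := fun (f : ℝ → ℂ) (hf : GenBV.MemBV A p f) (n : ℕ) =>
    GenBV.normBV_iterate_le hα0 hα1 hK1 ha h0 h1 hB hLY' hf n
  have hfrac : 0 ≤ (K + 1) / (1 - α) := by positivity
  refine ⟨α, K + 1, hα0, hα1, hK1, hLY', fun f hf n => ⟨(hit f hf n).1, ?_⟩, fun f hf => ?_⟩
  · refine (hit f hf n).2.2.trans ?_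
    rw [ENNReal.ofReal_add one_pos.le hfrac, add_mul]
    refine add_le_add (mul_le_mul_left (ENNReal.ofReal_le_ofReal ?_) _)
      (mul_le_mul_right le_add_self _)
    exact pow_le_one₀ hα0.le hα1.le
  -- Decay of `α ^ n` is useless against `‖f‖₁ = 0`, but then every iterate vanishes almost
  -- everywhere and has norm zero.
  · rcases eq_or_ne (GenBV.normOne f) 0 with hz | hz
    · refine Filter.Eventually.of_forall fun n => ?_
      have hn : GenBV.normOne ((GenBV.frobeniusPerron a τ)^[n] f) = 0 :=
        le_antisymm ((hit f hf n).2.1.trans hz.le) zero_le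
      rw [GenBV.normBV_eq_zero_of_normOne_eq_zero (hit f hf n).1.1.aestronglyMeasurable hn]
      exact zero_le
    · have hfin : GenBV.normBV A p f ≠ ⊤ := (ENNReal.add_lt_top.2 ⟨hf.2, hf.1.2⟩).ne
      have hlim : Filter.Tendsto (fun n : ℕ => ENNReal.ofReal (α ^ n) * GenBV.normBV A p f)
          Filter.atTop (nhds 0) := by
        have h2 : Filter.Tendsto (fun n : ℕ => ENNReal.ofReal (α ^ n)) Filter.atTop (nhds 0) := by
          have := ENNReal.tendsto_ofReal (tendsto_pow_atTop_nhds_zero_of_lt_one hα0.le hα1)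
          rwa [ENNReal.ofReal_zero] at this
        have := ENNReal.Tendsto.mul_const (b := GenBV.normBV A p f) h2 (Or.inr hfin)
        rwa [zero_mul] at this
      filter_upwards [hlim.eventually_lt_const (pos_iff_ne_zero.2 hz)] with n hn
      refine (hit f hf n).2.2.trans ?_
      rw [ENNReal.ofReal_add one_pos.le hfrac, add_mul, ENNReal.ofReal_one, one_mul]
      exact add_le_add_left hn.le _
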